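/- **Type preservation for Classical Higher-Order Processes (CHOP).** *Types.* Let $X$ range over type variables (atomic propositions), $l$ over parameter names, $x,y,z,w,u,v$ over channels, $p,r$ over process variables. Session types are $$A,B ::= A\otimes B \mid A ⅋ B \mid A\oplus B \mid A\,\&\,B \mid 0 \mid \top \mid 1 \mid \bot \mid {?A} \mid {!A} \mid \exists X.A \mid \forall X.A \mid X \mid X^\perp \mid [\Delta] \mid (\Delta),$$ where a process type $\Delta = l_1:A_1,\dots,l_n:A_n$ is a finite map from parameter names to session types; $[\Delta]$ (resp. $(\Delta)$) is the type of sending (resp. receiving) a process of type $\Delta$. Duality $A^\perp$ is as in classical linear logic (it swaps $\otimes/⅋$, $\oplus/\&$, $0/\top$, $1/\bot$, $?/!$, $\exists/\forall$, $X/X^\perp$), with $[\Delta]^\perp=(\Delta)$ and $(\Delta)^\perp=[\Delta]$. Environments $\Gamma=x_1:A_1,\dots$ and $\Theta=p_1:\Delta_1,\dots$ are finite maps from channels to session types and from process variables to process types; a comma joins environments with disjoint domains, $\cdot$ is the empty $\Theta$, and $?\Gamma$ is an environment with only types $?A$. A record $\rho=\{l_i=x_i\}_i$ is a finite map from parameter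 names to channels; when it is injective and has the domain of $\Delta$, $\Delta\rho$ is the environment obtained by renaming each $l$ to $\rho(l)$. *Processes*, up to $\alpha$-equivalence: $$\begin{array}{l}P,Q,R ::= x[y].(P\,|\,Q) \mid x(y).P \mid x[\mathsf{inl}].P \mid x[\mathsf{inr}].P \mid x.\mathsf{case}(P,Q) \mid {?x}[y].P \mid {!x}(y).P \mid x[A].P \mid x(X).P \mid x[(\rho)P] \mid x(p).P\\ \qquad\mid p\langle\rho\rangle \mid x[] \mid x().P \mid x.\mathsf{case}() \mid x\to y^A \mid (\nu x^A y)(P\,|\,Q) \mid Q[p:=(\rho)P].\end{array}$$ Here $y$ is bound in $P$ in $x[y].(P|Q)$, $x(y).P$, $?x[y].P$, $!x(y).P$; $X$ and $p$ are bound in $P$ in $x(X).P$ and $x(p).P$; in $(\nu x^Ay)(P|Q)$, $x$ is bound in $P$ and $y$ in $Q$; in $Q[p:=(\rho)P]$, $p$ is bound in $Q$; the abstraction $(\rho)P$, with $\rho$ injective, binds the image of $\rho$ in $P$, and $P$ has no other free channel. $\mathrm{fn}(P)$ is the set of free channels and process variables of $P$. *Typing* $\vdash_\Theta P\triangleright\Gamma$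 is defined inductively by the following rules ($\Rightarrow$ separates premises from conclusion): - $\vdash_\cdot x\to y^A\triangleright x:A^\perp,y:A$; - $\vdash_\Theta P\triangleright\Gamma,x:A$ and $\vdash_{\Theta'}Q\triangleright\Gamma',y:A^\perp$ $\Rightarrow$ $\vdash_{\Theta,\Theta'}(\nu x^Ay)(P|Q)\triangleright\Gamma,\Gamma'$; - $\vdash_\Theta P\triangleright\Gamma,y:A$ and $\vdash_{\Theta'}Q\triangleright\Gamma',x:B$ $\Rightarrow$ $\vdash_{\Theta,\Theta'}x[y].(P|Q)\triangleright\Gamma,\Gamma',x:A\otimes B$; - $\vdash_\Theta P\triangleright\Gamma,y:A,x:B$ $\Rightarrow$ $\vdash_\Theta x(y).P\triangleright\Gamma,x:A⅋B$; - $\vdash_\Theta P\triangleright\Gamma,x:A$ $\Rightarrow$ $\vdash_\Theta x[\mathsf{inl}].P\triangleright\Gamma,x:A\oplus B$; and $\vdash_\Theta P\triangleright\Gamma,x:B$ $\Rightarrow$ $\vdash_\Theta x[\mathsf{inr}].P\triangleright\Gamma,x:A\oplus B$; - $\vdash_\Theta P\triangleright\Gamma,x:A$ and $\vdash_\Theta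 Q\triangleright\Gamma,x:B$ $\Rightarrow$ $\vdash_\Theta x.\mathsf{case}(P,Q)\triangleright\Gamma,x:A\&B$; - $\vdash_\Theta P\triangleright\Gamma,y:A$ $\Rightarrow$ $\vdash_\Theta {?x}[y].P\triangleright\Gamma,x:{?A}$; and $\vdash_\cdot P\triangleright{?\Gamma},y:A$ $\Rightarrow$ $\vdash_\cdot{!x}(y).P\triangleright{?\Gamma},x:{!A}$; - $\vdash_\Theta P\triangleright\Gamma,x:B\{A/X\}$ $\Rightarrow$ $\vdash_\Theta x[A].P\triangleright\Gamma,x:\exists X.B$; and $\vdash_\Theta P\triangleright\Gamma,x:B$ with $X$ not free in $\Theta,\Gamma$ $\Rightarrow$ $\vdash_\Theta x(X).P\triangleright\Gamma,x:\forall X.B$; - $\vdash_\Theta P\triangleright\Gamma$ $\Rightarrow$ $\vdash_\Theta P\triangleright\Gamma,x:{?A}$; and $\vdash_\Theta P\triangleright\Gamma,y:{?A},z:{?A}$ $\Rightarrow$ $\vdash_\Theta P\{x/y,x/z\}\triangleright\Gamma,x:{?A}$; - $\vdash_\cdot x[]\triangleright x:1$; $\ \vdash_\Theta P\triangleright\Gamma$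 $\Rightarrow$ $\vdash_\Theta x().P\triangleright\Gamma,x:\bot$; $\ \vdash_\cdot x.\mathsf{case}()\triangleright\Gamma,x:\top$; - $\vdash_{p:\Delta}p\langle\rho\rangle\triangleright\Delta\rho$; $\ \vdash_\Theta P\triangleright\Delta\rho$ and $\vdash_{\Theta',p:\Delta}Q\triangleright\Gamma$ $\Rightarrow$ $\vdash_{\Theta,\Theta'}Q[p:=(\rho)P]\triangleright\Gamma$; - $\vdash_\Theta P\triangleright\Delta\rho$ $\Rightarrow$ $\vdash_\Theta x[(\rho)P]\triangleright x:[\Delta]$; and $\vdash_{\Theta,p:\Delta}P\triangleright\Gamma$ $\Rightarrow$ $\vdash_\Theta x(p).P\triangleright\Gamma,x:(\Delta)$. In all the rules below bound names are distinct from all other names, and a name that is bound on one side of a rule may not occur free on the other side. *Structural equivalence* $\equiv$ is the least congruence with - $x\to y^A\equiv y\to x^{A^\perp}$; $\quad(\nu z^Aw)(P|Q)\equiv(\nu w^{A^\perp}z)(Q|P)$; - $(\nu z^Aw)((\nu x^By)(P|Q)\,|\,R)\equiv(\nu x^By)(P\,|\,(\nu z^Aw)(Q|R))$ if [$z\in\mathrm{fn}(Q)$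 or $A$ is of the form $?D$] and [$y\in\mathrm{fn}(Q)$ or $B^\perp$ is of the form $?D$]. *Reduction* $\to$ is the least relation that contains the rules below, is closed under $\equiv$ on both sides, and is such that $P_1\to P_2$ implies $(\nu x^Ay)(P_1|Q)\to(\nu x^Ay)(P_2|Q)$, $(\nu x^Ay)(Q|P_1)\to(\nu x^Ay)(Q|P_2)$ and $P_1[p:=(\rho)Q]\to P_2[p:=(\rho)Q]$. Principal reductions: - $(\nu x^{A\otimes B}y)(x[x'].(P|Q)\,|\,y(y').R)\to(\nu x'^Ay')(P\,|\,(\nu x^By)(Q|R))$; - $(\nu x^{A\oplus B}y)(x[\mathsf{inl}].P\,|\,y.\mathsf{case}(Q,R))\to(\nu x^Ay)(P|Q)$; $\quad(\nu x^{A\oplus B}y)(x[\mathsf{inr}].P\,|\,y.\mathsf{case}(Q,R))\to(\nu x^By)(P|R)$; - $(\nu x^{?A}y)({?x}[u].Q\,|\,{!y}(v).P)\to(\nu u^Av)(Q|P)$; $\quad(\nu x^{?A}y)(P\,|\,{!y}(v).Q)\to P$; - $(\nu x^{?A}y)(P\{x/x',x/x''\}\,|\,{!y}(v).Q)\to(\nu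 x'^{?A}y')((\nu x''^{?A}y'')(P\,|\,{!y''}(v).Q)\,|\,{!y'}(v).Q)$; - $(\nu x^{\exists X.B}y)(x[A].P\,|\,y(X).Q)\to(\nu x^{B\{A/X\}}y)(P\,|\,Q\{A/X\})$; $\quad(\nu x^1y)(x[]\,|\,y().P)\to P$; - $(\nu x^{[\Delta]}y)(x[(\rho)P]\,|\,y(p).Q)\to Q[p:=(\rho)P]$; $\quad p\langle\rho\rangle[p:=(\rho')P]\to P\{\rho\circ\rho'^{-1}\}$ if $\rho$ and $\rho'$ have the same domain; - $(\nu x^Xy)(w\to x^X\,|\,P)\to P\{w/y\}$. $\eta$-expansions: - $x\to y^{A\otimes B}\to x(u).y[v].(u\to v^A\,|\,x\to y^B)$; $\quad x\to y^1\to x().y[]$; $\quad x\to y^0\to x.\mathsf{case}()$; - $x\to y^{A\oplus B}\to x.\mathsf{case}(y[\mathsf{inl}].x\to y^A,\;y[\mathsf{inr}].x\to y^B)$; $\quad x\to y^{?A}\to{!x}(u).{?y}[v].u\to v^A$; - $x\to y^{\exists X.A}\to x(X).y[X].x\to y^A$; $\quad x\to y^{[\Delta]}\to x(p).y[(\rho)p\langle\rho\rangle]$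 if $\mathrm{dom}(\rho)=\mathrm{dom}(\Delta)$. Commuting conversions for cuts: - $(\nu z^Aw)(x[y].(P|Q)\,|\,R)\to x[y].((\nu z^Aw)(P|R)\,|\,Q)$ if $z\in\mathrm{fn}(P)$, and $\to x[y].(P\,|\,(\nu z^Aw)(Q|R))$ if $z\in\mathrm{fn}(Q)$; - $(\nu z^Aw)(\pi.P\,|\,Q)\to\pi.(\nu z^Aw)(P|Q)$ for $\pi$ one of $x(y)$, $x[\mathsf{inl}]$, $x[\mathsf{inr}]$, $?x[y]$, $x[B]$, $x(X)$, $x()$; - $(\nu z^Aw)({!x}(y).P\,|\,Q)\to{!x}(y).(\nu z^Aw)(P|Q)$ if every derivable $\vdash_\Theta Q\triangleright\Delta,w:A^\perp$ has $\Theta=\cdot$ and only types of the form $?D$ in $\Delta$; - $(\nu z^Aw)(x.\mathsf{case}(P,Q)\,|\,R)\to x.\mathsf{case}((\nu z^Aw)(P|R),(\nu z^Aw)(Q|R))$; - $(\nu z^Aw)(x.\mathsf{case}()\,|\,Q)\to x.\mathsf{case}()$ if $Q$ has no free process variables. Commuting conversions for explicit substitutions, with $\sigma=[r:=(\rho)R]$: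 - $((\nu x^Ay)(P|Q))\sigma\to(\nu x^Ay)(P\sigma|Q)$ if $r\in\mathrm{fn}(P)$, and $\to(\nu x^Ay)(P|Q\sigma)$ if $r\in\mathrm{fn}(Q)$; - $(x[y].(P|Q))\sigma\to x[y].(P\sigma|Q)$ if $r\in\mathrm{fn}(P)$, and $\to x[y].(P|Q\sigma)$ if $r\in\mathrm{fn}(Q)$; - $(\pi.P)\sigma\to\pi.(P\sigma)$ for $\pi$ one of $x(y)$, $x[\mathsf{inl}]$, $x[\mathsf{inr}]$, $?x[y]$, $x[A]$, $x(X)$, $x(p)$, $x()$; - $(x.\mathsf{case}(P,Q))\sigma\to x.\mathsf{case}(P\sigma,Q\sigma)$; $\quad(x[(\rho')P])\sigma\to x[(\rho')(P\sigma)]$. **Theorem.** Let $\vdash_\Theta P\triangleright\Gamma$. Then, for every process $Q$, - if $P\equiv Q$, then $\vdash_\Theta Q\triangleright\Gamma$, and - if $P\to Q$, then $\vdash_\Theta Q\triangleright\Gamma$. -/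

import Mathlib

namespace CHOP

/-- Parameter names of abstractions. They are constants, never renamed. -/
abbrev Label : Type := ℕ

/-! ### Types

Binding is well-scoped: `Ty T` are the session types with free type variables in `T`, and the body
of a quantifier lives over `Option T`, with `none` the bound variable. So types are automatically
identified up to renaming of bound variables. A process type `l₁:A₁, …, lₙ:Aₙ` is a finite map from
labels to session types, given by its domain `s` and the types `Δ : s → Ty T`; so order is
irrelevant. -/

inductive Ty : Type → Type 1 where
  | tensor {T : Type} (A B : Ty T) : Ty T
  | par {T : Type} (A B : Ty T) : Ty T
  | plus {T : Type} (A B : Ty T) : Ty T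
  | with {T : Type} (A B : Ty T) : Ty T
  | zero {T : Type} : Ty T
  | top {T : Type} : Ty T
  | one {T : Type} : Ty T
  | bot {T : Type} : Ty T
  | whyNot {T : Type} (A : Ty T) : Ty T
  | ofCourse {T : Type} (A : Ty T) : Ty T
  | ex {T : Type} (A : Ty (Option T)) : Ty T
  | all {T : Type} (A : Ty (Option T)) : Ty T
  | tvar {T : Type} (X : T) : Ty T
  | dvar {T : Type} (X : T) : Ty T
  | provide {T : Type} (s : Finset Label) (Δ : s → Ty T) : Ty T
  | assume {T : Type} (s : Finset Label) (Δ : s → Ty T) : Ty T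

namespace Ty

/-- Linear-logic duality; `dvar X` is the dual of the atomic proposition `X`. -/
def dual : {T : Type} → Ty T → Ty T
  | _, tensor A B => par A.dual B.dual
  | _, par A B => tensor A.dual B.dual
  | _, plus A B => .with A.dual B.dual
  | _, .with A B => plus A.dual B.dual
  | _, zero => top
  | _, top => zero
  | _, one => bot
  | _, bot => one
  | _, whyNot A => ofCourse A.dual
  | _, ofCourse A => whyNot A.dual
  | _, ex A => all A.dual
  | _, all A => ex A.dual
  | _, tvar X => dvar X
  | _, dvar X => tvar X
  | _, provide s Δ => assume s Δ
  | _, assume s Δ => provide s Δ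

/-- Renaming of free type variables. -/
def rename : {T T' : Type} → (T → T') → Ty T → Ty T'
  | _, _, f, tensor A B => tensor (A.rename f) (B.rename f)
  | _, _, f, par A B => par (A.rename f) (B.rename f)
  | _, _, f, plus A B => plus (A.rename f) (B.rename f)
  | _, _, f, .with A B => .with (A.rename f) (B.rename f)
  | _, _, _, zero => zero
  | _, _, _, top => top
  | _, _, _, one => one
  | _, _, _, bot => bot
  | _, _, f, whyNot A => whyNot (A.rename f)
  | _, _, f, ofCourse A => ofCourse (A.rename f)
  | _, _, f, ex A => ex (A.rename (Option.map f))
  | _, _, f, all A => all (A.rename (Option.map f))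
  | _, _, f, tvar X => tvar (f X)
  | _, _, f, dvar X => dvar (f X)
  | _, _, f, provide s Δ => provide s (fun l => (Δ l).rename f)
  | _, _, f, assume s Δ => assume s (fun l => (Δ l).rename f)

/-- Weakening of a type by one fresh type variable. -/
def shift {T : Type} (A : Ty T) : Ty (Option T) := A.rename some

/-- A type substitution, pushed under a quantifier. -/
def lift {T T' : Type} (σ : T → Ty T') : Option T → Ty (Option T')
  | none => tvar none
  | some X => (σ X).shift

/-- Simultaneous capture-avoiding substitution of types for type variables. -/
def subst : {T T' : Type} → (T → Ty T') → Ty T → Ty T'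
  | _, _, σ, tensor A B => tensor (A.subst σ) (B.subst σ)
  | _, _, σ, par A B => par (A.subst σ) (B.subst σ)
  | _, _, σ, plus A B => plus (A.subst σ) (B.subst σ)
  | _, _, σ, .with A B => .with (A.subst σ) (B.subst σ)
  | _, _, _, zero => zero
  | _, _, _, top => top
  | _, _, _, one => one
  | _, _, _, bot => bot
  | _, _, σ, whyNot A => whyNot (A.subst σ)
  | _, _, σ, ofCourse A => ofCourse (A.subst σ)
  | _, _, σ, ex A => ex (A.subst (lift σ))
  | _, _, σ, all A => all (A.subst (lift σ))
  | _, _, σ, tvar X => σ X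
  | _, _, σ, dvar X => (σ X).dual
  | _, _, σ, provide s Δ => provide s (fun l => (Δ l).subst σ)
  | _, _, σ, assume s Δ => assume s (fun l => (Δ l).subst σ)

/-- The substitution `{A/X}` for the outermost bound type variable `X`. -/
def single {T : Type} (A : Ty T) : Option T → Ty T
  | none => A
  | some X => tvar X

/-- `A` is a client-request type `?B`. -/
def IsWhyNot {T : Type} (A : Ty T) : Prop := ∃ B : Ty T, A = whyNot B

end Ty

/-- Process types. -/
structure PTy (T : Type) : Type 1 where
  dom : Finset Label
  ty : dom → Ty T

def PTy.shift {T : Type} (Δ : PTy T) : PTy (Option T) := ⟨Δ.dom, fun l => (Δ.ty l).shift⟩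

/-! ### Processes

`Proc C V T` are the processes with free channels in `C`, free process variables in `V` and free
type variables in `T`. Every binder adds a name `none` to the scope of the term it binds in. So
processes are automatically identified up to alpha-equivalence. A record `ρ` is a finite map
`s → C` from labels to channels. An abstraction `(ρ)P` binds its parameters, one for each label of
a finite set `s`, and has no other free channel: its body is a process whose free channels are the
elements of `s`. -/

inductive Proc : Type → Type → Type → Type 1 where
  /-- `x[y].(P | Q)`, `y` bound in `P` -/
  | send {C V T : Type} (x : C) (P : Proc (Option C) V T) (Q : Proc C V T) : Proc C V T
  /-- `x(y).P`, `y` bound in `P` -/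
  | recv {C V T : Type} (x : C) (P : Proc (Option C) V T) : Proc C V T
  /-- `x[inl].P` -/
  | selL {C V T : Type} (x : C) (P : Proc C V T) : Proc C V T
  /-- `x[inr].P` -/
  | selR {C V T : Type} (x : C) (P : Proc C V T) : Proc C V T
  /-- `x.case(P, Q)` -/
  | offer {C V T : Type} (x : C) (P Q : Proc C V T) : Proc C V T
  /-- `?x[y].P`, `y` bound in `P` -/
  | client {C V T : Type} (x : C) (P : Proc (Option C) V T) : Proc C V T
  /-- `!x(y).P`, `y` bound in `P` -/
  | server {C V T : Type} (x : C) (P : Proc (Option C) V T) : Proc C V T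
  /-- `x[A].P` -/
  | sendTy {C V T : Type} (x : C) (A : Ty T) (P : Proc C V T) : Proc C V T
  /-- `x(X).P`, `X` bound in `P` -/
  | recvTy {C V T : Type} (x : C) (P : Proc C V (Option T)) : Proc C V T
  /-- `x[(ρ)P]` -/
  | sendProc {C V T : Type} (x : C) (s : Finset Label) (P : Proc s V T) : Proc C V T
  /-- `x(p).P`, the process variable `p` bound in `P` -/
  | recvProc {C V T : Type} (x : C) (P : Proc C (Option V) T) : Proc C V T
  /-- `p⟨ρ⟩` -/
  | run {C V T : Type} (p : V) (s : Finset Label) (ρ : s → C) : Proc C V T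
  /-- `x[]` -/
  | close {C V T : Type} (x : C) : Proc C V T
  /-- `x().P` -/
  | wait {C V T : Type} (x : C) (P : Proc C V T) : Proc C V T
  /-- `x.case()` -/
  | emptyOffer {C V T : Type} (x : C) : Proc C V T
  /-- `x → y^A`, where `A` is the type of `y` -/
  | link {C V T : Type} (x y : C) (A : Ty T) : Proc C V T
  /-- `(ν x^A y)(P | Q)`, where `x : A` is bound in `P` and `y` is bound in `Q` -/
  | cut {C V T : Type} (A : Ty T) (P Q : Proc (Option C) V T) : Proc C V T
  /-- `Q [p := (ρ)P]`, where `p` is bound in `Q` -/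
  | chop {C V T : Type} (Q : Proc C (Option V) T) (s : Finset Label) (P : Proc s V T) :
      Proc C V T

namespace Proc

/-- Renaming of free channels and free process variables. -/
def rename : {C C' V V' T : Type} → (C → C') → (V → V') → Proc C V T → Proc C' V' T
  | _, _, _, _, _, f, g, send x P Q => send (f x) (P.rename (Option.map f) g) (Q.rename f g)
  | _, _, _, _, _, f, g, recv x P => recv (f x) (P.rename (Option.map f) g)
  | _, _, _, _, _, f, g, selL x P => selL (f x) (P.rename f g)
  | _, _, _, _, _, f, g, selR x P => selR (f x) (P.rename f g)
  | _, _, _, _, _, f, g, offer x P Q => offer (f x) (P.rename f g) (Q.rename f g)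
  | _, _, _, _, _, f, g, client x P => client (f x) (P.rename (Option.map f) g)
  | _, _, _, _, _, f, g, server x P => server (f x) (P.rename (Option.map f) g)
  | _, _, _, _, _, f, g, sendTy x A P => sendTy (f x) A (P.rename f g)
  | _, _, _, _, _, f, g, recvTy x P => recvTy (f x) (P.rename f g)
  | _, _, _, _, _, f, g, sendProc x s P => sendProc (f x) s (P.rename id g)
  | _, _, _, _, _, f, g, recvProc x P => recvProc (f x) (P.rename f (Option.map g))
  | _, _, _, _, _, f, g, run p s ρ => run (g p) s (fun l => f (ρ l))
  | _, _, _, _, _, f, _, close x => close (f x)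
  | _, _, _, _, _, f, g, wait x P => wait (f x) (P.rename f g)
  | _, _, _, _, _, f, _, emptyOffer x => emptyOffer (f x)
  | _, _, _, _, _, f, _, link x y A => link (f x) (f y) A
  | _, _, _, _, _, f, g, cut A P Q =>
      cut A (P.rename (Option.map f) g) (Q.rename (Option.map f) g)
  | _, _, _, _, _, f, g, chop Q s P => chop (Q.rename f (Option.map g)) s (P.rename id g)

/-- Renaming of free channels. -/
def renC {C C' V T : Type} (f : C → C') (P : Proc C V T) : Proc C' V T := P.rename f id

/-- Renaming of free process variables. -/
def renV {C V V' T : Type} (g : V → V') (P : Proc C V T) : Proc C V' T := P.rename id g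

/-- Substitution of types for the free type variables of a process. -/
def tsubst : {C V T T' : Type} → (T → Ty T') → Proc C V T → Proc C V T'
  | _, _, _, _, σ, send x P Q => send x (P.tsubst σ) (Q.tsubst σ)
  | _, _, _, _, σ, recv x P => recv x (P.tsubst σ)
  | _, _, _, _, σ, selL x P => selL x (P.tsubst σ)
  | _, _, _, _, σ, selR x P => selR x (P.tsubst σ)
  | _, _, _, _, σ, offer x P Q => offer x (P.tsubst σ) (Q.tsubst σ)
  | _, _, _, _, σ, client x P => client x (P.tsubst σ)
  | _, _, _, _, σ, server x P => server x (P.tsubst σ)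
  | _, _, _, _, σ, sendTy x A P => sendTy x (A.subst σ) (P.tsubst σ)
  | _, _, _, _, σ, recvTy x P => recvTy x (P.tsubst (Ty.lift σ))
  | _, _, _, _, σ, sendProc x s P => sendProc x s (P.tsubst σ)
  | _, _, _, _, σ, recvProc x P => recvProc x (P.tsubst σ)
  | _, _, _, _, _, run p s ρ => run p s ρ
  | _, _, _, _, _, close x => close x
  | _, _, _, _, σ, wait x P => wait x (P.tsubst σ)
  | _, _, _, _, _, emptyOffer x => emptyOffer x
  | _, _, _, _, σ, link x y A => link x y (A.subst σ)
  | _, _, _, _, σ, cut A P Q => cut (A.subst σ) (P.tsubst σ) (Q.tsubst σ)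
  | _, _, _, _, σ, chop Q s P => chop (Q.tsubst σ) s (P.tsubst σ)

/-- Weakening of a process by one fresh type variable. -/
def tshift {C V T : Type} (P : Proc C V T) : Proc C V (Option T) :=
  P.tsubst (fun X => Ty.tvar (some X))

/-- Free channels. -/
def fc : {C V T : Type} → Proc C V T → Set C
  | _, _, _, send x P Q => {x} ∪ some ⁻¹' P.fc ∪ Q.fc
  | _, _, _, recv x P => {x} ∪ some ⁻¹' P.fc
  | _, _, _, selL x P => {x} ∪ P.fc
  | _, _, _, selR x P => {x} ∪ P.fc
  | _, _, _, offer x P Q => {x} ∪ P.fc ∪ Q.fc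
  | _, _, _, client x P => {x} ∪ some ⁻¹' P.fc
  | _, _, _, server x P => {x} ∪ some ⁻¹' P.fc
  | _, _, _, sendTy x _ P => {x} ∪ P.fc
  | _, _, _, recvTy x P => {x} ∪ P.fc
  | _, _, _, sendProc x _ _ => {x}
  | _, _, _, recvProc x P => {x} ∪ P.fc
  | _, _, _, run _ _ ρ => Set.range ρ
  | _, _, _, close x => {x}
  | _, _, _, wait x P => {x} ∪ P.fc
  | _, _, _, emptyOffer x => {x}
  | _, _, _, link x y _ => {x, y}
  | _, _, _, cut _ P Q => some ⁻¹' P.fc ∪ some ⁻¹' Q.fc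
  | _, _, _, chop Q _ _ => Q.fc

/-- Free process variables. -/
def fv : {C V T : Type} → Proc C V T → Set V
  | _, _, _, send _ P Q => P.fv ∪ Q.fv
  | _, _, _, recv _ P => P.fv
  | _, _, _, selL _ P => P.fv
  | _, _, _, selR _ P => P.fv
  | _, _, _, offer _ P Q => P.fv ∪ Q.fv
  | _, _, _, client _ P => P.fv
  | _, _, _, server _ P => P.fv
  | _, _, _, sendTy _ _ P => P.fv
  | _, _, _, recvTy _ P => P.fv
  | _, _, _, sendProc _ _ P => P.fv
  | _, _, _, recvProc _ P => some ⁻¹' P.fv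
  | _, _, _, run p _ _ => {p}
  | _, _, _, close _ => ∅
  | _, _, _, wait _ P => P.fv
  | _, _, _, emptyOffer _ => ∅
  | _, _, _, link _ _ _ => ∅
  | _, _, _, cut _ P Q => P.fv ∪ Q.fv
  | _, _, _, chop Q _ P => some ⁻¹' Q.fv ∪ P.fv

end Proc

/-- Exchange of the two innermost bound names. -/
def swap {N : Type} : Option (Option N) → Option (Option N)
  | none => some none
  | some none => none
  | some (some n) => some (some n)

/-! ### Environments -/

/-- Partial maps from names to types (derivable judgements only have finite ones). -/
abbrev Ctx (N : Type) (α : Type 1) : Type 1 := N → Option α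

namespace Ctx

def empty {N : Type} {α : Type 1} : Ctx N α := fun _ => none

open Classical in
/-- `Γ, x:A`; always used with `x` undefined in `Γ`. -/
noncomputable def set {N : Type} {α : Type 1} (Γ : Ctx N α) (x : N) (A : α) : Ctx N α :=
  Function.update Γ x (some A)

/-- `Γ, y:A` for a new innermost name `y`. -/
def ext {N : Type} {α : Type 1} (Γ : Ctx N α) (A : α) : Ctx (Option N) α
  | none => some A
  | some n => Γ n

/-- `Γ = Γ₁, Γ₂`, the union of two environments that share no names. -/
def Split {N : Type} {α : Type 1} (Γ Γ₁ Γ₂ : Ctx N α) : Prop :=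
  ∀ n, (Γ₁ n = none ∧ Γ n = Γ₂ n) ∨ (Γ₂ n = none ∧ Γ n = Γ₁ n)

end Ctx

/-- Channel environments `Γ`. -/
abbrev Env (C T : Type) : Type 1 := Ctx C (Ty T)

/-- Process environments `Θ`. -/
abbrev PEnv (V T : Type) : Type 1 := Ctx V (PTy T)

def Env.shift {C T : Type} (Γ : Env C T) : Env C (Option T) := fun c => (Γ c).map Ty.shift

def PEnv.shift {V T : Type} (Θ : PEnv V T) : PEnv V (Option T) := fun p => (Θ p).map PTy.shift

/-- All types in `Γ` are of the form `?A`. -/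
def Env.AllWhyNot {C T : Type} (Γ : Env C T) : Prop := ∀ c A, Γ c = some A → A.IsWhyNot

/-! ### Typing -/

/-- `Typed Θ P Γ` is the judgement `⊢_Θ P ▹ Γ`. -/
inductive Typed : {C V T : Type} → PEnv V T → Proc C V T → Env C T → Prop where
  | axiomLink {C V T : Type} {x y : C} {A : Ty T} (hxy : x ≠ y) :
      Typed (Ctx.empty : PEnv V T) (.link x y A) ((Ctx.empty.set x A.dual).set y A)
  | cut {C V T : Type} {Θ Θ₁ Θ₂ : PEnv V T} {Γ Γ₁ Γ₂ : Env C T} {A : Ty T}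
      {P Q : Proc (Option C) V T} (hΘ : Θ.Split Θ₁ Θ₂) (hΓ : Γ.Split Γ₁ Γ₂)
      (hP : Typed Θ₁ P (Γ₁.ext A)) (hQ : Typed Θ₂ Q (Γ₂.ext A.dual)) :
      Typed Θ (.cut A P Q) Γ
  | tensor {C V T : Type} {Θ Θ₁ Θ₂ : PEnv V T} {Γ Γ₁ Γ₂ : Env C T} {x : C} {A B : Ty T}
      {P : Proc (Option C) V T} {Q : Proc C V T} (hΘ : Θ.Split Θ₁ Θ₂) (hΓ : Γ.Split Γ₁ Γ₂)
      (hx : Γ x = none) (hP : Typed Θ₁ P (Γ₁.ext A)) (hQ : Typed Θ₂ Q (Γ₂.set x B)) :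
      Typed Θ (.send x P Q) (Γ.set x (.tensor A B))
  | par {C V T : Type} {Θ : PEnv V T} {Γ : Env C T} {x : C} {A B : Ty T}
      {P : Proc (Option C) V T} (hx : Γ x = none) (hP : Typed Θ P ((Γ.set x B).ext A)) :
      Typed Θ (.recv x P) (Γ.set x (.par A B))
  | plus₁ {C V T : Type} {Θ : PEnv V T} {Γ : Env C T} {x : C} {A B : Ty T} {P : Proc C V T}
      (hx : Γ x = none) (hP : Typed Θ P (Γ.set x A)) :
      Typed Θ (.selL x P) (Γ.set x (.plus A B))
  | plus₂ {C V T : Type} {Θ : PEnv V T} {Γ : Env C T} {x : C} {A B : Ty T} {P : Proc C V T}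
      (hx : Γ x = none) (hP : Typed Θ P (Γ.set x B)) :
      Typed Θ (.selR x P) (Γ.set x (.plus A B))
  | with {C V T : Type} {Θ : PEnv V T} {Γ : Env C T} {x : C} {A B : Ty T} {P Q : Proc C V T}
      (hx : Γ x = none) (hP : Typed Θ P (Γ.set x A)) (hQ : Typed Θ Q (Γ.set x B)) :
      Typed Θ (.offer x P Q) (Γ.set x (.with A B))
  | whyNot {C V T : Type} {Θ : PEnv V T} {Γ : Env C T} {x : C} {A : Ty T}
      {P : Proc (Option C) V T} (hx : Γ x = none) (hP : Typed Θ P (Γ.ext A)) :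
      Typed Θ (.client x P) (Γ.set x (.whyNot A))
  | ofCourse {C V T : Type} {Γ : Env C T} {x : C} {A : Ty T} {P : Proc (Option C) V T}
      (hx : Γ x = none) (hΓ : Γ.AllWhyNot)
      (hP : Typed (Ctx.empty : PEnv V T) P (Γ.ext A)) :
      Typed (Ctx.empty : PEnv V T) (.server x P) (Γ.set x (.ofCourse A))
  | ex {C V T : Type} {Θ : PEnv V T} {Γ : Env C T} {x : C} {A : Ty T} {B : Ty (Option T)}
      {P : Proc C V T} (hx : Γ x = none) (hP : Typed Θ P (Γ.set x (B.subst (Ty.single A)))) :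
      Typed Θ (.sendTy x A P) (Γ.set x (.ex B))
  | all {C V T : Type} {Θ : PEnv V T} {Γ : Env C T} {x : C} {B : Ty (Option T)}
      {P : Proc C V (Option T)} (hx : Γ x = none)
      (hP : Typed (PEnv.shift Θ) P ((Env.shift Γ).set x B)) :
      Typed Θ (.recvTy x P) (Γ.set x (.all B))
  | weaken {C V T : Type} {Θ : PEnv V T} {Γ : Env C T} {x : C} {A : Ty T} {P : Proc C V T}
      (hx : Γ x = none) (hP : Typed Θ P Γ) :
      Typed Θ P (Γ.set x (.whyNot A))
  /-- The two innermost names of `P` (the names `y` and `z`) are both replaced by `x`. -/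
  | contract {C V T : Type} {Θ : PEnv V T} {Γ : Env C T} {x : C} {A : Ty T}
      {P : Proc (Option (Option C)) V T} (hx : Γ x = none)
      (hP : Typed Θ P ((Γ.ext (.whyNot A)).ext (.whyNot A))) :
      Typed Θ (P.renC (fun c => c.join.getD x)) (Γ.set x (.whyNot A))
  | one {C V T : Type} {x : C} :
      Typed (Ctx.empty : PEnv V T) (.close x) (Ctx.empty.set x .one)
  | bot {C V T : Type} {Θ : PEnv V T} {Γ : Env C T} {x : C} {P : Proc C V T}
      (hx : Γ x = none) (hP : Typed Θ P Γ) :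
      Typed Θ (.wait x P) (Γ.set x .bot)
  | top {C V T : Type} {Γ : Env C T} {x : C} (hx : Γ x = none) (hfin : {c | Γ c ≠ none}.Finite) :
      Typed (Ctx.empty : PEnv V T) (.emptyOffer x) (Γ.set x .top)
  /-- The environment `Γ` is `Δρ`. -/
  | ident {C V T : Type} {p : V} {s : Finset Label} {Δ : s → Ty T} {ρ : s → C} {Γ : Env C T}
      (hρ : Function.Injective ρ) (hΓ : ∀ l, Γ (ρ l) = some (Δ l))
      (hΓ' : ∀ c, c ∉ Set.range ρ → Γ c = none) :
      Typed ((Ctx.empty : PEnv V T).set p ⟨s, Δ⟩) (.run p s ρ) Γ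
  | chop {C V T : Type} {Θ Θ₁ Θ₂ : PEnv V T} {Γ : Env C T} {s : Finset Label} {Δ : s → Ty T}
      {P : Proc s V T} {Q : Proc C (Option V) T} (hΘ : Θ.Split Θ₁ Θ₂)
      (hP : Typed Θ₁ P (fun l => some (Δ l))) (hQ : Typed (Θ₂.ext ⟨s, Δ⟩) Q Γ) :
      Typed Θ (.chop Q s P) Γ
  | provide {C V T : Type} {Θ : PEnv V T} {x : C} {s : Finset Label} {Δ : s → Ty T}
      {P : Proc s V T} (hP : Typed Θ P (fun l => some (Δ l))) :
      Typed Θ (.sendProc x s P) (Ctx.empty.set x (.provide s Δ))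
  | assume {C V T : Type} {Θ : PEnv V T} {Γ : Env C T} {x : C} {s : Finset Label}
      {Δ : s → Ty T} {P : Proc C (Option V) T} (hx : Γ x = none)
      (hP : Typed (Θ.ext ⟨s, Δ⟩) P Γ) :
      Typed Θ (.recvProc x P) (Γ.set x (.assume s Δ))

/-! ### Structural equivalence

The least congruence that contains the three axioms. In the axioms and in the reductions below a
component of the left-hand side written `P.renC some`, `P.renC (Option.map some)` or `P.renV some`
is one in which the bound name in question does not occur. -/

inductive SEquiv : {C V T : Type} → Proc C V T → Proc C V T → Prop where
  | linkSymm {C V T : Type} (x y : C) (A : Ty T) :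
      SEquiv (.link x y A : Proc C V T) (.link y x A.dual)
  | cutComm {C V T : Type} (A : Ty T) (P Q : Proc (Option C) V T) :
      SEquiv (.cut A P Q) (.cut A.dual Q P)
  /-- `(ν z^A w)((ν x^B y)(P | Q) | R) ≡ (ν x^B y)(P | (ν z^A w)(Q | R))`, where `z` is not free in
  `P`, and where `z` and `y` are both used by `Q`, or have a type `?D` (so that they need not be
  used). -/
  | cutAssoc {C V T : Type} (A B : Ty T) (P : Proc (Option C) V T)
      (Q : Proc (Option (Option C)) V T) (R : Proc (Option C) V T)
      (hz : some none ∈ Q.fc ∨ A.IsWhyNot) (hy : none ∈ Q.fc ∨ B.dual.IsWhyNot) :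
      SEquiv (.cut A (.cut B (P.renC (Option.map some)) Q) R)
        (.cut B P (.cut A (Q.renC swap) (R.renC (Option.map some))))
  | refl {C V T : Type} (P : Proc C V T) : SEquiv P P
  | symm {C V T : Type} {P Q : Proc C V T} : SEquiv P Q → SEquiv Q P
  | trans {C V T : Type} {P Q R : Proc C V T} : SEquiv P Q → SEquiv Q R → SEquiv P R
  | send {C V T : Type} {x : C} {P P' : Proc (Option C) V T} {Q Q' : Proc C V T} :
      SEquiv P P' → SEquiv Q Q' → SEquiv (.send x P Q) (.send x P' Q')
  | recv {C V T : Type} {x : C} {P P' : Proc (Option C) V T} :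
      SEquiv P P' → SEquiv (.recv x P) (.recv x P')
  | selL {C V T : Type} {x : C} {P P' : Proc C V T} :
      SEquiv P P' → SEquiv (.selL x P) (.selL x P')
  | selR {C V T : Type} {x : C} {P P' : Proc C V T} :
      SEquiv P P' → SEquiv (.selR x P) (.selR x P')
  | offer {C V T : Type} {x : C} {P P' Q Q' : Proc C V T} :
      SEquiv P P' → SEquiv Q Q' → SEquiv (.offer x P Q) (.offer x P' Q')
  | client {C V T : Type} {x : C} {P P' : Proc (Option C) V T} :
      SEquiv P P' → SEquiv (.client x P) (.client x P')
  | server {C V T : Type} {x : C} {P P' : Proc (Option C) V T} :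
      SEquiv P P' → SEquiv (.server x P) (.server x P')
  | sendTy {C V T : Type} {x : C} {A : Ty T} {P P' : Proc C V T} :
      SEquiv P P' → SEquiv (.sendTy x A P) (.sendTy x A P')
  | recvTy {C V T : Type} {x : C} {P P' : Proc C V (Option T)} :
      SEquiv P P' → SEquiv (.recvTy x P) (.recvTy x P')
  | sendProc {C V T : Type} {x : C} {s : Finset Label} {P P' : Proc s V T} :
      SEquiv P P' → SEquiv (.sendProc x s P) (.sendProc x s P')
  | recvProc {C V T : Type} {x : C} {P P' : Proc C (Option V) T} :
      SEquiv P P' → SEquiv (.recvProc x P) (.recvProc x P')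
  | wait {C V T : Type} {x : C} {P P' : Proc C V T} :
      SEquiv P P' → SEquiv (.wait x P) (.wait x P')
  | cut {C V T : Type} {A : Ty T} {P P' Q Q' : Proc (Option C) V T} :
      SEquiv P P' → SEquiv Q Q' → SEquiv (.cut A P Q) (.cut A P' Q')
  | chop {C V T : Type} {Q Q' : Proc C (Option V) T} {s : Finset Label} {P P' : Proc s V T} :
      SEquiv Q Q' → SEquiv P P' → SEquiv (.chop Q s P) (.chop Q' s P')

/-! ### Reduction -/

/-- Principal reductions. -/
inductive Principal : {C V T : Type} → Proc C V T → Proc C V T → Prop where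
  | tensorPar {C V T : Type} (A B : Ty T) (P Q : Proc (Option C) V T)
      (R : Proc (Option (Option C)) V T) :
      Principal
        (.cut (.tensor A B) (.send none (P.renC (Option.map some)) Q) (.recv none R))
        (.cut A P (.cut B (Q.renC (Option.map some)) (R.renC swap)))
  | selectL {C V T : Type} (A B : Ty T) (P Q R : Proc (Option C) V T) :
      Principal (.cut (.plus A B) (.selL none P) (.offer none Q R)) (.cut A P Q)
  | selectR {C V T : Type} (A B : Ty T) (P Q R : Proc (Option C) V T) :
      Principal (.cut (.plus A B) (.selR none P) (.offer none Q R)) (.cut B P R)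
  | serve {C V T : Type} (A : Ty T) (P Q : Proc (Option C) V T) :
      Principal
        (.cut (.whyNot A) (.client none (Q.renC (Option.map some)))
          (.server none (P.renC (Option.map some))))
        (.cut A Q P)
  | discard {C V T : Type} (A : Ty T) (P : Proc C V T) (Q : Proc (Option (Option C)) V T) :
      Principal (.cut (.whyNot A) (P.renC some) (.server none Q)) P
  /-- `(ν x^?A y)(P{x/x', x/x''} | !y(v).Q)` replicates its server. -/
  | replicate {C V T : Type} (A : Ty T) (P : Proc (Option (Option C)) V T)
      (Q : Proc (Option C) V T) :
      Principal
        (.cut (.whyNot A) (P.renC Option.join) (.server none (Q.renC (Option.map some))))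
        (.cut (.whyNot A)
          (.cut (.whyNot A) P
            (.server none (Q.renC (Option.map (fun c => some (some c))))))
          (.server none (Q.renC (Option.map some))))
  | poly {C V T : Type} (A : Ty T) (B : Ty (Option T)) (P : Proc (Option C) V T)
      (Q : Proc (Option C) V (Option T)) :
      Principal (.cut (.ex B) (.sendTy none A P) (.recvTy none Q))
        (.cut (B.subst (Ty.single A)) P (Q.tsubst (Ty.single A)))
  | unit {C V T : Type} (P : Proc C V T) :
      Principal (.cut .one (.close none) (.wait none (P.renC some))) P
  | higherOrder {C V T : Type} (s' : Finset Label) (Δ : s' → Ty T) (s : Finset Label)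
      (P : Proc s V T) (Q : Proc C (Option V) T) :
      Principal
        (.cut (.provide s' Δ) (.sendProc none s P) (.recvProc none (Q.renC some)))
        (.chop Q s P)
  /-- `p⟨ρ⟩ [p := (ρ')P] ⟶ P{ρ ∘ ρ'⁻¹}`; here the formal parameters are the labels. -/
  | run {C V T : Type} (s : Finset Label) (ρ : s → C) (P : Proc s V T) :
      Principal (.chop (.run none s ρ) s P) (P.renC ρ)
  | link {C V T : Type} (X : T) (w : C) (P : Proc (Option C) V T) :
      Principal (.cut (.tvar X) (.link (some w) none (.tvar X)) P)
        (P.renC (fun c => c.getD w))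

/-- Expansions of links. -/
inductive Eta : {C V T : Type} → Proc C V T → Proc C V T → Prop where
  | tensor {C V T : Type} (x y : C) (A B : Ty T) :
      Eta (.link x y (.tensor A B) : Proc C V T)
        (.recv x (.send (some y) (.link (some none) none A) (.link (some x) (some y) B)))
  | one {C V T : Type} (x y : C) :
      Eta (.link x y .one : Proc C V T) (.wait x (.close y))
  | plus {C V T : Type} (x y : C) (A B : Ty T) :
      Eta (.link x y (.plus A B) : Proc C V T)
        (.offer x (.selL y (.link x y A)) (.selR y (.link x y B)))
  | zero {C V T : Type} (x y : C) :
      Eta (.link x y .zero : Proc C V T) (.emptyOffer x)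
  | whyNot {C V T : Type} (x y : C) (A : Ty T) :
      Eta (.link x y (.whyNot A) : Proc C V T)
        (.server x (.client (some y) (.link (some none) none A)))
  | ex {C V T : Type} (x y : C) (A : Ty (Option T)) :
      Eta (.link x y (.ex A) : Proc C V T)
        (.recvTy x (.sendTy y (.tvar none) (.link x y A)))
  | provide {C V T : Type} (x y : C) (s : Finset Label) (Δ : s → Ty T) :
      Eta (.link x y (.provide s Δ) : Proc C V T)
        (.recvProc x (.sendProc y s (.run none s id)))

/-- Commuting conversions. -/
inductive Commute : {C V T : Type} → Proc C V T → Proc C V T → Prop where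
  | cutSend₁ {C V T : Type} (A : Ty T) (x : C) (P : Proc (Option (Option C)) V T)
      (Q : Proc C V T) (R : Proc (Option C) V T) (hz : some none ∈ P.fc) :
      Commute (.cut A (.send (some x) P (Q.renC some)) R)
        (.send x (.cut A (P.renC swap) (R.renC (Option.map some))) Q)
  | cutSend₂ {C V T : Type} (A : Ty T) (x : C) (P Q R : Proc (Option C) V T)
      (hz : none ∈ Q.fc) :
      Commute (.cut A (.send (some x) (P.renC (Option.map some)) Q) R)
        (.send x P (.cut A Q R))
  | cutRecv {C V T : Type} (A : Ty T) (x : C) (P : Proc (Option (Option C)) V T)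
      (Q : Proc (Option C) V T) :
      Commute (.cut A (.recv (some x) P) Q)
        (.recv x (.cut A (P.renC swap) (Q.renC (Option.map some))))
  | cutSelL {C V T : Type} (A : Ty T) (x : C) (P Q : Proc (Option C) V T) :
      Commute (.cut A (.selL (some x) P) Q) (.selL x (.cut A P Q))
  | cutSelR {C V T : Type} (A : Ty T) (x : C) (P Q : Proc (Option C) V T) :
      Commute (.cut A (.selR (some x) P) Q) (.selR x (.cut A P Q))
  | cutOffer {C V T : Type} (A : Ty T) (x : C) (P Q R : Proc (Option C) V T) :
      Commute (.cut A (.offer (some x) P Q) R) (.offer x (.cut A P R) (.cut A Q R))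
  /-- `(ν z^A w)(!x(y).P | Q) ⟶ !x(y).(ν z^A w)(P | Q)`, provided that the right premise of the cut
  is always of the form `⊢ Q ▹ ?Δ, w:A^⊥`, with no process variables. -/
  | cutServer {C V T : Type} (A : Ty T) (x : C) (P : Proc (Option (Option C)) V T)
      (Q : Proc (Option C) V T)
      (hQ : ∀ (Θ : PEnv V T) (Δ : Env C T), Typed Θ Q (Δ.ext A.dual) →
        Θ = Ctx.empty ∧ Δ.AllWhyNot) :
      Commute (.cut A (.server (some x) P) Q)
        (.server x (.cut A (P.renC swap) (Q.renC (Option.map some))))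
  | cutClient {C V T : Type} (A : Ty T) (x : C) (P : Proc (Option (Option C)) V T)
      (Q : Proc (Option C) V T) :
      Commute (.cut A (.client (some x) P) Q)
        (.client x (.cut A (P.renC swap) (Q.renC (Option.map some))))
  | cutSendTy {C V T : Type} (A : Ty T) (x : C) (B : Ty T) (P Q : Proc (Option C) V T) :
      Commute (.cut A (.sendTy (some x) B P) Q) (.sendTy x B (.cut A P Q))
  | cutRecvTy {C V T : Type} (A : Ty T) (x : C) (P : Proc (Option C) V (Option T))
      (Q : Proc (Option C) V T) :
      Commute (.cut A (.recvTy (some x) P) Q) (.recvTy x (.cut A.shift P Q.tshift))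
  | cutWait {C V T : Type} (A : Ty T) (x : C) (P Q : Proc (Option C) V T) :
      Commute (.cut A (.wait (some x) P) Q) (.wait x (.cut A P Q))
  /-- `Q` is dropped, so it must not use process variables, which are linear. -/
  | cutEmptyOffer {C V T : Type} (A : Ty T) (x : C) (Q : Proc (Option C) V T) (hQ : Q.fv = ∅) :
      Commute (.cut A (.emptyOffer (some x)) Q) (.emptyOffer x)
  | chopCut₁ {C V T : Type} (A : Ty T) (P : Proc (Option C) (Option V) T)
      (Q : Proc (Option C) V T) (s : Finset Label) (R : Proc s V T) (hr : none ∈ P.fv) :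
      Commute (.chop (.cut A P (Q.renV some)) s R) (.cut A (.chop P s R) Q)
  | chopCut₂ {C V T : Type} (A : Ty T) (P : Proc (Option C) V T)
      (Q : Proc (Option C) (Option V) T) (s : Finset Label) (R : Proc s V T) (hr : none ∈ Q.fv) :
      Commute (.chop (.cut A (P.renV some) Q) s R) (.cut A P (.chop Q s R))
  | chopSend₁ {C V T : Type} (x : C) (P : Proc (Option C) (Option V) T)
      (Q : Proc C V T) (s : Finset Label) (R : Proc s V T) (hr : none ∈ P.fv) :
      Commute (.chop (.send x P (Q.renV some)) s R) (.send x (.chop P s R) Q)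
  | chopSend₂ {C V T : Type} (x : C) (P : Proc (Option C) V T)
      (Q : Proc C (Option V) T) (s : Finset Label) (R : Proc s V T) (hr : none ∈ Q.fv) :
      Commute (.chop (.send x (P.renV some) Q) s R) (.send x P (.chop Q s R))
  | chopRecv {C V T : Type} (x : C) (P : Proc (Option C) (Option V) T) (s : Finset Label)
      (R : Proc s V T) :
      Commute (.chop (.recv x P) s R) (.recv x (.chop P s R))
  | chopSelL {C V T : Type} (x : C) (P : Proc C (Option V) T) (s : Finset Label)
      (R : Proc s V T) :
      Commute (.chop (.selL x P) s R) (.selL x (.chop P s R))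
  | chopSelR {C V T : Type} (x : C) (P : Proc C (Option V) T) (s : Finset Label)
      (R : Proc s V T) :
      Commute (.chop (.selR x P) s R) (.selR x (.chop P s R))
  | chopOffer {C V T : Type} (x : C) (P Q : Proc C (Option V) T) (s : Finset Label)
      (R : Proc s V T) :
      Commute (.chop (.offer x P Q) s R) (.offer x (.chop P s R) (.chop Q s R))
  | chopClient {C V T : Type} (x : C) (P : Proc (Option C) (Option V) T) (s : Finset Label)
      (R : Proc s V T) :
      Commute (.chop (.client x P) s R) (.client x (.chop P s R))
  | chopSendTy {C V T : Type} (x : C) (A : Ty T) (P : Proc C (Option V) T) (s : Finset Label)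
      (R : Proc s V T) :
      Commute (.chop (.sendTy x A P) s R) (.sendTy x A (.chop P s R))
  | chopRecvTy {C V T : Type} (x : C) (P : Proc C (Option V) (Option T)) (s : Finset Label)
      (R : Proc s V T) :
      Commute (.chop (.recvTy x P) s R) (.recvTy x (.chop P s R.tshift))
  | chopSendProc {C V T : Type} (x : C) (s' : Finset Label) (P : Proc s' (Option V) T)
      (s : Finset Label) (R : Proc s V T) :
      Commute (.chop (.sendProc x s' P : Proc C (Option V) T) s R)
        (.sendProc x s' (.chop P s R))
  | chopRecvProc {C V T : Type} (x : C) (P : Proc C (Option (Option V)) T) (s : Finset Label)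
      (R : Proc s V T) :
      Commute (.chop (.recvProc x P) s R) (.recvProc x (.chop (P.renV swap) s (R.renV some)))
  | chopWait {C V T : Type} (x : C) (P : Proc C (Option V) T) (s : Finset Label)
      (R : Proc s V T) :
      Commute (.chop (.wait x P) s R) (.wait x (.chop P s R))

/-- The reduction relation `P ⟶ Q`. -/
inductive Red : {C V T : Type} → Proc C V T → Proc C V T → Prop where
  | principal {C V T : Type} {P Q : Proc C V T} : Principal P Q → Red P Q
  | eta {C V T : Type} {P Q : Proc C V T} : Eta P Q → Red P Q
  | commute {C V T : Type} {P Q : Proc C V T} : Commute P Q → Red P Q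
  | cutL {C V T : Type} {A : Ty T} {P₁ P₂ Q : Proc (Option C) V T} :
      Red P₁ P₂ → Red (.cut A P₁ Q) (.cut A P₂ Q)
  | cutR {C V T : Type} {A : Ty T} {P Q₁ Q₂ : Proc (Option C) V T} :
      Red Q₁ Q₂ → Red (.cut A P Q₁) (.cut A P Q₂)
  | chop {C V T : Type} {Q₁ Q₂ : Proc C (Option V) T} {s : Finset Label} {P : Proc s V T} :
      Red Q₁ Q₂ → Red (.chop Q₁ s P) (.chop Q₂ s P)
  | equiv {C V T : Type} {P P' Q Q' : Proc C V T} :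
      SEquiv P P' → Red P' Q' → SEquiv Q' Q → Red P Q

end CHOP

/-! The obstacle is that weakening and contraction leave no trace in the shape of a process, and
contraction even renames it. A derivation for a cut may therefore end in a structural rule, and
typing cannot be inverted directly. The remedy is `Proc.Der`, an equivalent system defined by
recursion on the process. Surplus `?`-declarations are absorbed at the leaves. Where an environment
is divided between premises, the parts may share `?`-declarations (`Ctx.Join`). A request `?x[y].P`
keeps `x` available to its continuation. Inversion then holds by definition, and compatibility with
the congruence rules is immediate.

The structural rules become one admissible principle. `Ctx.Ren Ty.IsWhyNot f Γ Γ'` says that `Γ'`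
arises from `Γ` by renaming along `f`, contracting and adding only `?`-declarations, and
`Proc.Der.rename` shows that `Der` is preserved. Conversely `Proc.Der.of_rename` recovers a
derivation of `P` from one of its renaming. This is how the hypothesis "the bound name does not
occur here", written `P.renC some` in the reduction rules, is exploited. With the choice `fun _ =>
False` for the types allowed to be contracted or added, the same notions describe disjoint splitting
and injective renaming, as needed for the linear process variables.

The two systems agree on finite environments. `Typed.der` absorbs each structural rule by renaming.
`Proc.Der.typed` types the two premises of a cut or an output over disjoint copies of the scope, and
then contracts everything shared in a single renaming along the codiagonal; this rests on
`Typed.rename`, which factors any such renaming into contractions, an injective renaming and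
weakenings.

It remains to check the axioms of equivalence and reduction for `Der`. Each case inverts the
derivation, regroups the parts of the environment (`Join.assoc`), and moves bound names between
them. Two facts decide where a name goes: a free channel is declared (`Der.ne_none_of_mem_fc`), and
a process variable is declared exactly when it is free (`Der.mem_fv_iff`). -/

namespace CHOP

/-! ### Session types: duality, renaming and substitution -/

namespace Ty

@[simp] theorem dual_dual {T : Type} (A : Ty T) : A.dual.dual = A := by
  induction A <;> simp_all [dual]

theorem rename_dual {T T' : Type} (f : T → T') (A : Ty T) :
    A.dual.rename f = (A.rename f).dual := by
  induction A generalizing T' <;> simp_all [dual, rename]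

theorem lift_comp_map {T T' T'' : Type} (σ : T' → Ty T'') (f : T → T') :
    lift σ ∘ Option.map f = lift (σ ∘ f) := by
  funext X; cases X <;> rfl

theorem subst_rename {T T' T'' : Type} (f : T → T') (σ : T' → Ty T'') (A : Ty T) :
    (A.rename f).subst σ = A.subst (σ ∘ f) := by
  induction A generalizing T' T'' <;> simp_all [subst, rename, lift_comp_map]

theorem rename_rename {T T' T'' : Type} (f : T → T') (g : T' → T'') (A : Ty T) :
    (A.rename f).rename g = A.rename (g ∘ f) := by
  induction A generalizing T' T'' <;> simp_all [rename, Option.map_comp_map]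

theorem lift_rename {T T' T'' : Type} (σ : T → Ty T') (f : T' → T'') :
    (fun X => (lift σ X).rename (Option.map f)) = lift (fun X => (σ X).rename f) := by
  funext X
  cases X with
  | none => rfl
  | some X => simp only [lift, shift, rename_rename]; rfl

theorem rename_subst {T T' T'' : Type} (σ : T → Ty T') (f : T' → T'') (A : Ty T) :
    (A.subst σ).rename f = A.subst (fun X => (σ X).rename f) := by
  induction A generalizing T' T'' <;> simp_all [subst, rename, lift_rename, rename_dual]

theorem subst_dual {T T' : Type} (σ : T → Ty T') (A : Ty T) :
    A.dual.subst σ = (A.subst σ).dual := by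
  induction A generalizing T' <;> simp_all [dual, subst]

theorem shift_subst_lift {T T' : Type} (σ : T → Ty T') (A : Ty T) :
    A.shift.subst (lift σ) = (A.subst σ).shift := by
  simp only [shift, subst_rename, rename_subst]; rfl

theorem lift_subst {T T' T'' : Type} (σ : T → Ty T') (τ : T' → Ty T'') :
    (fun X => (lift σ X).subst (lift τ)) = lift (fun X => (σ X).subst τ) := by
  funext X
  cases X with
  | none => rfl
  | some X => simp only [lift, shift_subst_lift]

theorem subst_subst {T T' T'' : Type} (σ : T → Ty T') (τ : T' → Ty T'') (A : Ty T) :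
    (A.subst σ).subst τ = A.subst (fun X => (σ X).subst τ) := by
  induction A generalizing T' T'' <;> simp_all [subst, lift_subst, subst_dual]

theorem lift_tvar {T : Type} : lift (tvar : T → Ty T) = tvar := by
  funext X; cases X <;> rfl

@[simp] theorem subst_tvar {T : Type} (A : Ty T) : A.subst tvar = A := by
  induction A <;> simp_all [subst, lift_tvar, dual]

/-- Weakening is a renaming on types but a substitution on processes (`Proc.tshift`); this
reconciles the two. -/
theorem rename_eq_subst {T T' : Type} (f : T → T') (A : Ty T) :
    A.rename f = A.subst (tvar ∘ f) := by
  rw [← subst_rename, subst_tvar]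

theorem shift_eq_subst {T : Type} (A : Ty T) : A.shift = A.subst (fun X => tvar (some X)) :=
  rename_eq_subst _ _

@[simp] theorem shift_subst_single {T : Type} (A B : Ty T) : B.shift.subst (single A) = B := by
  rw [shift, subst_rename]; exact subst_tvar B

/-- Needed for stability of the rule for `∃` under type substitution: the witness may be
instantiated before or after `σ` acts. -/
theorem subst_single_subst {T T' : Type} (σ : T → Ty T') (A : Ty T) (B : Ty (Option T)) :
    (B.subst (single A)).subst σ = (B.subst (lift σ)).subst (single (A.subst σ)) := by
  rw [subst_subst, subst_subst]
  congr 1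
  funext X
  cases X with
  | none => rfl
  | some X => simp [lift, single, subst]

/-- For the expansion of a link at `∃X.A`: below the binder `X` the body has its other variables
shifted, and sending `X` itself as witness gives `A` back. -/
theorem rename_some_subst_single {T : Type} (A : Ty (Option T)) :
    (A.rename (Option.map some)).subst (single (tvar none)) = A := by
  rw [subst_rename]
  convert subst_tvar A
  funext X
  cases X <;> rfl

theorem shift_dual {T : Type} (A : Ty T) : A.dual.shift = A.shift.dual := rename_dual _ _

theorem IsWhyNot.subst {T T' : Type} (σ : T → Ty T') {A : Ty T} (h : A.IsWhyNot) :
    (A.subst σ).IsWhyNot := by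
  obtain ⟨B, rfl⟩ := h; exact ⟨_, rfl⟩

theorem IsWhyNot.shift {T : Type} {A : Ty T} (h : A.IsWhyNot) : A.shift.IsWhyNot := by
  obtain ⟨B, rfl⟩ := h; exact ⟨_, rfl⟩

/-- Duality always changes the head constructor. Hence the side condition `x ≠ y` of the link axiom
need not be part of `Der`. -/
theorem dual_ne {T : Type} (A : Ty T) : A.dual ≠ A := by
  cases A <;> simp [dual]

end Ty

/-! ### Functoriality of renaming on processes -/

namespace Proc

theorem rename_rename {C C' C'' V V' V'' T : Type} (f : C → C') (f' : C' → C'') (g : V → V')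
    (g' : V' → V'') (P : Proc C V T) :
    (P.rename f g).rename f' g' = P.rename (f' ∘ f) (g' ∘ g) := by
  induction P generalizing C' C'' V' V'' with
  | _ => simp only [rename, Option.map_comp_map, Function.comp_id, Function.comp_apply, *]

@[simp] theorem rename_id {C V T : Type} (P : Proc C V T) : P.rename id id = P := by
  induction P <;> simp_all [rename]

theorem renC_renC {C C' C'' V T : Type} (f : C → C') (f' : C' → C'') (P : Proc C V T) :
    (P.renC f).renC f' = P.renC (f' ∘ f) := rename_rename _ _ _ _ P

theorem renC_of_eq_id {C V T : Type} {f : C → C} (h : ∀ c, f c = c) (P : Proc C V T) :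
    P.renC f = P := by
  obtain rfl : f = id := funext h
  exact rename_id P

end Proc

/-! ### Environments: sharing, renaming and regrouping -/

namespace Ctx

variable {N N' N'' : Type} {α : Type 1}

open Classical in
/-- The environment `Γ` without `x`. -/
noncomputable def erase (Γ : Ctx N α) (x : N) : Ctx N α := Function.update Γ x none

/-- The environment `Γ` over a scope with one more name, which is not declared. -/
def wk (Γ : Ctx N α) : Ctx (Option N) α
  | none => none
  | some n => Γ n

open Classical in
@[grind =] theorem set_apply (Γ : Ctx N α) (x y : N) (A : α) :
    Γ.set x A y = if y = x then some A else Γ y := by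
  simp [set, Function.update_apply]

open Classical in
@[grind =] theorem erase_apply (Γ : Ctx N α) (x y : N) :
    Γ.erase x y = if y = x then none else Γ y := by
  simp [erase, Function.update_apply]

@[simp, grind =] theorem ext_none (Γ : Ctx N α) (A : α) : Γ.ext A none = some A := rfl
@[simp, grind =] theorem ext_some (Γ : Ctx N α) (A : α) (n : N) : Γ.ext A (some n) = Γ n := rfl
@[simp, grind =] theorem wk_none (Γ : Ctx N α) : Γ.wk none = none := rfl
@[simp, grind =] theorem wk_some (Γ : Ctx N α) (n : N) : Γ.wk (some n) = Γ n := rfl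
@[simp, grind =] theorem empty_apply (n : N) : (empty : Ctx N α) n = none := rfl

/-- `Γ = Γ₁, Γ₂`, except that declarations with a type in `W` may be shared. -/
def Join (W : α → Prop) (Γ Γ₁ Γ₂ : Ctx N α) : Prop :=
  ∀ n, (Γ₁ n = none ∧ Γ n = Γ₂ n) ∨ (Γ₂ n = none ∧ Γ n = Γ₁ n) ∨
    ∃ A, W A ∧ Γ n = some A ∧ Γ₁ n = some A ∧ Γ₂ n = some A

/-- `Γ'` results from `Γ` by renaming along `f`, where declarations with a type in `W` may be
contracted and added. -/
structure Ren (W : α → Prop) (f : N → N') (Γ : Ctx N α) (Γ' : Ctx N' α) : Prop where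
  pres : ∀ c A, Γ c = some A → Γ' (f c) = some A
  lin : ∀ c c' A, f c = f c' → Γ c = some A → Γ c' ≠ none → c = c' ∨ W A
  new : ∀ c' A, Γ' c' = some A → W A ∨ ∃ c, f c = c' ∧ Γ c = some A

/-- Lets the lemmas on shared environments be reused for disjoint ones, by allowing no type to be
shared. -/
theorem split_iff_join (Γ Γ₁ Γ₂ : Ctx N α) :
    Γ.Split Γ₁ Γ₂ ↔ Join (fun _ => False) Γ Γ₁ Γ₂ := by
  simp [Split, Join]

variable {W : α → Prop}

theorem Split.join {Γ Γ₁ Γ₂ : Ctx N α} (h : Γ.Split Γ₁ Γ₂) : Join W Γ Γ₁ Γ₂ := fun n =>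
  (h n).imp_right Or.inl

theorem Ren.refl (Γ : Ctx N α) : Ren W id Γ Γ :=
  ⟨fun _ _ h => h, fun _ _ _ h _ _ => .inl h, fun c _ h => .inr ⟨c, rfl, h⟩⟩

theorem Ren.comp {f : N → N'} {f' : N' → N''} {Γ : Ctx N α} {Γ' : Ctx N' α} {Γ'' : Ctx N'' α}
    (h : Ren W f Γ Γ') (h' : Ren W f' Γ' Γ'') : Ren W (f' ∘ f) Γ Γ'' where
  pres c A hc := h'.pres _ _ (h.pres _ _ hc)
  lin c c' A hf hc hc' := by
    obtain ⟨B, hB⟩ := Option.ne_none_iff_exists'.1 hc'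
    rcases h'.lin _ _ A hf (h.pres _ _ hc) (by simp [h.pres _ _ hB]) with h1 | h1
    · exact h.lin _ _ _ h1 hc hc'
    · exact .inr h1
  new c A hc := by
    rcases h'.new c A hc with h1 | ⟨d, rfl, h1⟩
    · exact .inl h1
    · rcases h.new d A h1 with h2 | ⟨e, rfl, h2⟩
      · exact .inl h2
      · exact .inr ⟨e, rfl, h2⟩

theorem Ren.ext {f : N → N'} {Γ : Ctx N α} {Γ' : Ctx N' α} (h : Ren W f Γ Γ') (A : α) :
    Ren W (Option.map f) (Γ.ext A) (Γ'.ext A) where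
  pres c B hc := by
    cases c with
    | none => exact hc
    | some c => exact h.pres c B hc
  lin c c' B hf hc hc' := by
    cases c <;> cases c' <;> simp at hf ⊢
    exact h.lin _ _ _ hf hc hc'
  new c B hc := by
    cases c with
    | none => exact .inr ⟨none, rfl, hc⟩
    | some c =>
      rcases h.new c B hc with h1 | ⟨d, rfl, h1⟩
      · exact .inl h1
      · exact .inr ⟨some d, rfl, h1⟩

/-- Since `A` may not be contracted, `x` is the only declared name over `f x`, so erasing `f x`
destroys no other declaration. For `A` in `W` this would fail. -/
theorem Ren.erase {f : N → N'} {Γ : Ctx N α} {Γ' : Ctx N' α} (h : Ren W f Γ Γ') {x : N} {A : α}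
    (hx : Γ x = some A) (hA : ¬ W A) : Ren W f (Γ.erase x) (Γ'.erase (f x)) where
  pres c B hc := by
    have := h.pres c B
    have := h.lin x c A
    grind
  lin c c' B hf hc hc' := by
    have := h.lin c c' B
    grind
  new c B hc := by
    have := h.new c B
    grind

theorem Ren.set {f : N → N'} {Γ : Ctx N α} {Γ' : Ctx N' α} (h : Ren W f Γ Γ') {x : N} {A : α}
    (hx : Γ x = some A) (hA : ¬ W A) (B : α) : Ren W f (Γ.set x B) (Γ'.set (f x) B) where
  pres c B hc := by
    have := h.pres c B
    have := h.lin x c A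
    grind
  lin c c' B hf hc hc' := by
    have := h.lin c c' B
    have := h.lin x c' A
    have := h.lin x c A
    grind
  new c B hc := by
    have := h.new c B
    grind

/-- A division of `Γ` is transported to `Γ'`: linear declarations follow their unique preimage, and
all declarations in `W` go to both parts. -/
theorem Ren.join {f : N → N'} {Γ Γ₁ Γ₂ : Ctx N α} {Γ' : Ctx N' α} (h : Ren W f Γ Γ')
    (hj : Join W Γ Γ₁ Γ₂) :
    ∃ Γ₁' Γ₂' : Ctx N' α, Join W Γ' Γ₁' Γ₂' ∧ Ren W f Γ₁ Γ₁' ∧ Ren W f Γ₂ Γ₂' := by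
  classical
  -- The transported part keeps from `Γ'` the images of the names of `Δ` and every declaration in
  -- `W`, old or new; the latter is admissible as weakening.
  have key : ∀ Δ : Ctx N α, (∀ c A, Δ c = some A → Γ c = some A) →
      Ren W f Δ (fun c' => if (∃ c, f c = c' ∧ Δ c ≠ none) ∨ (∃ A, Γ' c' = some A ∧ W A)
        then Γ' c' else none) := by
    intro Δ hΔ
    refine ⟨fun c A hc => ?_, fun c c' A hf hc hc' => ?_, fun c' A hc' => ?_⟩
    · have := h.pres c A (hΔ c A hc)
      grind
    · obtain ⟨B, hB⟩ := Option.ne_none_iff_exists'.1 hc'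
      exact h.lin c c' A hf (hΔ c A hc) (by simp [hΔ _ _ hB])
    · split_ifs at hc' with hif
      rcases hif with ⟨c, rfl, hc⟩ | ⟨B, hB, hW⟩
      · obtain ⟨B, hB⟩ := Option.ne_none_iff_exists'.1 hc
        have := h.pres c B (hΔ c B hB)
        grind
      · grind
  refine ⟨_, _, ?_, key Γ₁ fun c A hc => ?_, key Γ₂ fun c A hc => ?_⟩
  · intro c'
    rcases hA : Γ' c' with _ | A
    · grind
    · by_cases hW : W A
      · right; right; exact ⟨A, by simp [hW, hA]⟩
      -- A linear declaration of `Γ'` is not new, and its preimage is unique, so it lies in the same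
      -- part as that preimage and in no other.
      · obtain ⟨c, rfl, hc⟩ := (h.new c' A hA).resolve_left hW
        have huniq : ∀ d, f d = f c → Γ d ≠ none → d = c := fun d hd hd' =>
          ((h.lin c d A hd.symm hc hd').resolve_right hW).symm
        have h1 : ∀ d, f d = f c → (Γ₁ d ≠ none ∨ Γ₂ d ≠ none) → d = c := by
          intro d hd hd'
          apply huniq d hd
          have := hj d
          grind
        have := hj c
        grind
  · have := hj c; grind
  · have := hj c; grind

theorem Join.symm {Γ Γ₁ Γ₂ : Ctx N α} (h : Join W Γ Γ₁ Γ₂) : Join W Γ Γ₂ Γ₁ := fun n => by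
  have := h n; grind

theorem Split.symm {Γ Γ₁ Γ₂ : Ctx N α} (h : Γ.Split Γ₁ Γ₂) : Γ.Split Γ₂ Γ₁ := fun n =>
  (h n).symm

theorem Join.left {Γ Γ₁ Γ₂ : Ctx N α} (h : Join W Γ Γ₁ Γ₂) {n : N} {A : α} (hn : Γ₁ n = some A) :
    Γ n = some A := by
  have := h n; grind

theorem Join.right {Γ Γ₁ Γ₂ : Ctx N α} (h : Join W Γ Γ₁ Γ₂) {n : N} {A : α}
    (hn : Γ₂ n = some A) : Γ n = some A := h.symm.left hn

theorem Split.ext_right {Γ Γ₁ Γ₂ : Ctx N α} (h : Γ.Split Γ₁ Γ₂) (A : α) :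
    (Γ.ext A).Split Γ₁.wk (Γ₂.ext A)
  | none => .inl ⟨rfl, rfl⟩
  | some n => h n

theorem split_empty_left {Γ Γ₂ : Ctx N α} (h : Γ.Split empty Γ₂) : Γ = Γ₂ := by
  funext n; have := h n; grind

theorem split_empty (Γ : Ctx N α) : Γ.Split Γ empty := fun _ => .inr ⟨rfl, rfl⟩

/-- Subderivations of a joint environment can be reassociated. -/
theorem Split.assoc {Γ Γ₁ Γ₂ Γ₃ Γ₄ : Ctx N α} (h : Γ.Split Γ₁ Γ₂) (h' : Γ₁.Split Γ₃ Γ₄) :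
    ∃ Δ, Γ.Split Γ₃ Δ ∧ Δ.Split Γ₄ Γ₂ := by
  refine ⟨fun n => (Γ₄ n).or (Γ₂ n), fun n => ?_, fun n => ?_⟩ <;>
  · have := h n
    have := h' n
    grind [Option.or]

theorem Join.assoc {Γ Γ₁ Γ₂ Γ₃ Γ₄ : Ctx N α} (h : Join W Γ Γ₁ Γ₂) (h' : Join W Γ₁ Γ₃ Γ₄) :
    ∃ Δ, Join W Γ Γ₃ Δ ∧ Join W Δ Γ₄ Γ₂ := by
  -- The bias of `Option.or` is harmless: a name declared in both parts has in both the type it has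
  -- in `Γ`.
  refine ⟨fun n => (Γ₄ n).or (Γ₂ n), fun n => ?_, fun n => ?_⟩ <;>
  · have := h n
    have := h' n
    grind [Option.or]

end Ctx

/-! ### Changing types in environments, and restriction along a renaming -/

namespace Ctx

variable {N N' : Type} {α β : Type 1} {W : α → Prop}

/-- The environment with all types changed by `φ`. -/
def map (φ : α → β) (Γ : Ctx N α) : Ctx N β := fun n => (Γ n).map φ

@[grind =] theorem map_apply (φ : α → β) (Γ : Ctx N α) (n : N) :
    Γ.map φ n = (Γ n).map φ := rfl

@[simp] theorem map_empty (φ : α → β) : (empty : Ctx N α).map φ = empty := rfl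

@[simp] theorem map_ext (φ : α → β) (Γ : Ctx N α) (A : α) :
    (Γ.ext A).map φ = (Γ.map φ).ext (φ A) := by
  funext n; cases n <;> rfl

@[simp] theorem map_set (φ : α → β) (Γ : Ctx N α) (x : N) (A : α) :
    (Γ.set x A).map φ = (Γ.map φ).set x (φ A) := by
  funext n; grind

@[simp] theorem map_erase (φ : α → β) (Γ : Ctx N α) (x : N) :
    (Γ.erase x).map φ = (Γ.map φ).erase x := by
  funext n; grind

theorem Join.map {W' : β → Prop} {φ : α → β} (hφ : ∀ A, W A → W' (φ A)) {Γ Γ₁ Γ₂ : Ctx N α}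
    (h : Join W Γ Γ₁ Γ₂) : Join W' (Γ.map φ) (Γ₁.map φ) (Γ₂.map φ) := by
  intro n
  rcases h n with ⟨h1, h2⟩ | ⟨h1, h2⟩ | ⟨A, hA, h1, h2, h3⟩
  · simp [Ctx.map, h1, h2]
  · simp [Ctx.map, h1, h2]
  · exact .inr (.inr ⟨φ A, hφ A hA, by simp [Ctx.map, h1, h2, h3]⟩)

theorem Split.map {φ : α → β} {Γ Γ₁ Γ₂ : Ctx N α}
    (h : Γ.Split Γ₁ Γ₂) : Split (Γ.map φ) (Γ₁.map φ) (Γ₂.map φ) := by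
  rw [split_iff_join] at *
  exact h.map (φ := φ) fun _ h => h

theorem Ren.map {W' : β → Prop} {φ : α → β} (hφ : ∀ A, W A → W' (φ A)) {f : N → N'}
    {Γ : Ctx N α} {Γ' : Ctx N' α} (h : Ren W f Γ Γ') : Ren W' f (Γ.map φ) (Γ'.map φ) where
  pres c B hc := by
    obtain ⟨A, hA, rfl⟩ := Option.map_eq_some_iff.1 hc
    simp [Ctx.map, h.pres c A hA]
  lin c c' B hf hc hc' := by
    obtain ⟨A, hA, rfl⟩ := Option.map_eq_some_iff.1 hc
    have := h.lin c c' A hf hA (by grind)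
    grind
  new c B hc := by
    obtain ⟨A, hA, rfl⟩ := Option.map_eq_some_iff.1 hc
    have := h.new c A hA
    grind

/-- No declared name lies over `f x`, as its image would be declared. So the insertion contracts
nothing, and `B` is arbitrary. -/
theorem Ren.insert {f : N → N'} {Γ : Ctx N α} {Γ' : Ctx N' α} (h : Ren W f Γ Γ') {x : N}
    (hx' : Γ' (f x) = none) (B : α) :
    Ren W f (Γ.set x B) (Γ'.set (f x) B) where
  pres c A hc := by
    have := h.pres c A
    grind
  lin c c' A hf hc hc' := by
    have := h.lin c c' A
    have h1 := h.pres c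
    have h2 := h.pres c'
    rcases h3 : Γ c' with _ | D <;> grind
  new c A hc := by
    have := h.new c A
    grind

/-- `Γ'` is as in `Ren`, and `Γ` is the whole restriction of `Γ'` along `f`. -/
structure Res (W : α → Prop) (f : N → N') (Γ : Ctx N α) (Γ' : Ctx N' α) : Prop
    extends Ren W f Γ Γ' where
  eq : ∀ c, Γ' (f c) = Γ c

theorem Res.refl (Γ : Ctx N α) : Res W id Γ Γ := ⟨.refl Γ, fun _ => rfl⟩

theorem Res.ext {f : N → N'} {Γ : Ctx N α} {Γ' : Ctx N' α} (h : Res W f Γ Γ') (A : α) :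
    Res W (Option.map f) (Γ.ext A) (Γ'.ext A) :=
  ⟨h.toRen.ext A, fun c => by cases c <;> simp [h.eq]⟩

theorem Res.erase {f : N → N'} {Γ : Ctx N α} {Γ' : Ctx N' α} (h : Res W f Γ Γ') {x : N} {A : α}
    (hx : Γ x = some A) (hA : ¬ W A) : Res W f (Γ.erase x) (Γ'.erase (f x)) :=
  ⟨h.toRen.erase hx hA, fun c => by
    have := h.eq c
    have := h.eq x
    have := h.lin x c A
    grind⟩

theorem Res.set {f : N → N'} {Γ : Ctx N α} {Γ' : Ctx N' α} (h : Res W f Γ Γ') {x : N} {A : α}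
    (hx : Γ x = some A) (hA : ¬ W A) (B : α) : Res W f (Γ.set x B) (Γ'.set (f x) B) :=
  ⟨h.toRen.set hx hA B, fun c => by
    have := h.eq c
    have := h.eq x
    have := h.lin x c A
    grind⟩

theorem Res.part {f : N → N'} {Γ : Ctx N α} {Γ' Γ₁' : Ctx N' α} (h : Res W f Γ Γ')
    (hle : ∀ n A, Γ₁' n = some A → Γ' n = some A) : Res W f (fun n => Γ₁' (f n)) Γ₁' where
  pres c A hc := hc
  lin c c' A hf hc hc' := h.lin c c' A hf (by rw [← h.eq, hle _ _ hc]) (by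
    obtain ⟨B, hB⟩ := Option.ne_none_iff_exists'.1 hc'
    simp [← h.eq, hle _ _ hB])
  new c A hc := by
    have := h.new c A (hle _ _ hc)
    grind
  eq c := rfl

/-- The parts of `Γ'` are simply pulled back along `f`; since `Γ` is itself the pullback of `Γ'`,
the sharing conditions hold name by name. -/
theorem Res.join {f : N → N'} {Γ : Ctx N α} {Γ' Γ₁' Γ₂' : Ctx N' α} (h : Res W f Γ Γ')
    (hj : Join W Γ' Γ₁' Γ₂') :
    ∃ Γ₁ Γ₂ : Ctx N α, Join W Γ Γ₁ Γ₂ ∧ Res W f Γ₁ Γ₁' ∧ Res W f Γ₂ Γ₂' :=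
  ⟨_, _, fun n => by simpa only [h.eq] using hj (f n), h.part fun _ _ => hj.left,
    h.part fun _ _ => hj.right⟩

theorem Res.split {f : N → N'} {Γ : Ctx N α} {Γ' Γ₁' Γ₂' : Ctx N' α}
    (h : Res (fun _ => False) f Γ Γ') (hj : Γ'.Split Γ₁' Γ₂') :
    ∃ Γ₁ Γ₂ : Ctx N α, Γ.Split Γ₁ Γ₂ ∧ Res (fun _ => False) f Γ₁ Γ₁' ∧
      Res (fun _ => False) f Γ₂ Γ₂' := by
  simp only [split_iff_join] at *
  exact h.join hj

theorem Res.map {W' : β → Prop} {φ : α → β} (hφ : ∀ A, W A → W' (φ A)) {f : N → N'}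
    {Γ : Ctx N α} {Γ' : Ctx N' α} (h : Res W f Γ Γ') : Res W' f (Γ.map φ) (Γ'.map φ) :=
  ⟨h.toRen.map hφ, fun c => by simp [Ctx.map, h.eq]⟩

theorem Res.eq_empty {f : N → N'} {Γ : Ctx N α} (h : Res W f Γ empty) : Γ = empty :=
  funext fun c => (h.eq c).symm

/-- A name which is not declared can be removed from the scope. -/
theorem Res.some_wk (Γ : Ctx N α) : Res W some Γ Γ.wk where
  pres _ _ hc := hc
  lin _ _ _ hf _ _ := .inl (Option.some_injective _ hf)
  new
    | some c, _, hc => .inr ⟨c, rfl, hc⟩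
  eq _ := rfl

/-- A name whose type is in `W` can be removed from the scope. -/
theorem Res.some_ext (Γ : Ctx N α) {A : α} (hA : W A) : Res W some Γ (Γ.ext A) where
  pres _ _ hc := hc
  lin _ _ _ hf _ _ := .inl (Option.some_injective _ hf)
  new
    | none, B, hc => .inl (by cases hc; exact hA)
    | some c, _, hc => .inr ⟨c, rfl, hc⟩
  eq _ := rfl

theorem Ren.split {f : N → N'} {Γ Γ₁ Γ₂ : Ctx N α} {Γ' : Ctx N' α}
    (h : Ren (fun _ => False) f Γ Γ') (hj : Γ.Split Γ₁ Γ₂) :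
    ∃ Γ₁' Γ₂' : Ctx N' α, Γ'.Split Γ₁' Γ₂' ∧ Ren (fun _ => False) f Γ₁ Γ₁' ∧
      Ren (fun _ => False) f Γ₂ Γ₂' := by
  simp only [split_iff_join] at *
  exact h.join hj

theorem Ren.eq_empty {f : N → N'} {Γ' : Ctx N' α} (h : Ren (fun _ => False) f empty Γ') :
    Γ' = empty := by
  funext c
  by_contra hc
  obtain ⟨A, hA⟩ := Option.ne_none_iff_exists'.1 hc
  obtain ⟨d, -, hd⟩ := (h.new c A hA).resolve_left id
  cases hd

/-- Puts the target of an injective renaming into the form `Γ, x:A` of the conclusion of a typing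
rule. -/
theorem Ren.eq_set {f : N → N'} {Γ : Ctx N α} {Γ' : Ctx N' α} {x : N} {A : α}
    (h : Ren (fun _ => False) f (Γ.set x A) Γ') (hx : Γ x = none) :
    Γ' = (Γ'.erase (f x)).set (f x) A ∧ Ren (fun _ => False) f Γ (Γ'.erase (f x)) := by
  have h1 := h.pres x A (by grind)
  have h2 := h.erase (x := x) (A := A) (by grind) id
  have h3 : (Γ.set x A).erase x = Γ := by funext n; grind
  rw [h3] at h2
  exact ⟨by funext n; grind, h2⟩

@[simp] theorem set_erase {Γ : Ctx N α} {x : N} {A : α} (h : Γ x = none) :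
    (Γ.set x A).erase x = Γ := by
  funext n; grind

@[simp] theorem set_set (Γ : Ctx N α) (x : N) (A B : α) :
    (Γ.set x A).set x B = Γ.set x B := by
  funext n; grind

theorem erase_set {Γ : Ctx N α} {x : N} {A : α} (h : Γ x = some A) :
    (Γ.erase x).set x A = Γ := by
  funext n; grind

@[simp] theorem erase_set_same (Γ : Ctx N α) (x : N) (A : α) :
    (Γ.erase x).set x A = Γ.set x A := by
  funext n; grind

@[simp] theorem set_same (Γ : Ctx N α) (x : N) (A : α) : Γ.set x A x = some A := by grind

@[simp] theorem erase_same (Γ : Ctx N α) (x : N) : Γ.erase x x = none := by grind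

end Ctx

/-! ### The syntax-directed system -/

open Ctx

/-- Injective renaming of an environment of process variables. -/
abbrev VRen {V V' T : Type} (g : V → V') (Θ : PEnv V T) (Θ' : PEnv V' T) : Prop :=
  Ren (fun _ => False) g Θ Θ'

namespace Proc

/-- A syntax-directed presentation of typing: weakening happens at the leaves, and contraction
where an environment is divided among the premises of a rule or where a request is made. -/
def Der : {C V T : Type} → Proc C V T → PEnv V T → Env C T → Prop
  | _, _, _, send x P Q, Θ, Γ => ∃ A B Θ₁ Θ₂ Γ₁ Γ₂, Θ.Split Θ₁ Θ₂ ∧ Γ x = some (.tensor A B) ∧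
      Join Ty.IsWhyNot (Γ.erase x) Γ₁ Γ₂ ∧ P.Der Θ₁ (Γ₁.ext A) ∧ Q.Der Θ₂ (Γ₂.set x B)
  | _, _, _, recv x P, Θ, Γ => ∃ A B, Γ x = some (.par A B) ∧ P.Der Θ ((Γ.set x B).ext A)
  | _, _, _, selL x P, Θ, Γ => ∃ A B, Γ x = some (.plus A B) ∧ P.Der Θ (Γ.set x A)
  | _, _, _, selR x P, Θ, Γ => ∃ A B, Γ x = some (.plus A B) ∧ P.Der Θ (Γ.set x B)
  | _, _, _, offer x P Q, Θ, Γ => ∃ A B, Γ x = some (.with A B) ∧ P.Der Θ (Γ.set x A) ∧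
      Q.Der Θ (Γ.set x B)
  | _, _, _, client x P, Θ, Γ => ∃ A, Γ x = some (.whyNot A) ∧ P.Der Θ (Γ.ext A)
  | _, _, _, server x P, Θ, Γ => ∃ A, Γ x = some (.ofCourse A) ∧ Θ = empty ∧
      (∀ c B, c ≠ x → Γ c = some B → B.IsWhyNot) ∧ P.Der empty ((Γ.erase x).ext A)
  | _, _, _, sendTy x A P, Θ, Γ => ∃ B, Γ x = some (.ex B) ∧
      P.Der Θ (Γ.set x (B.subst (Ty.single A)))
  | _, _, _, recvTy x P, Θ, Γ => ∃ B, Γ x = some (.all B) ∧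
      P.Der (Θ.map PTy.shift) ((Γ.map Ty.shift).set x B)
  | _, _, _, sendProc x s P, Θ, Γ => ∃ Δ, Γ x = some (.provide s Δ) ∧
      (∀ c B, c ≠ x → Γ c = some B → B.IsWhyNot) ∧ P.Der Θ (fun l => some (Δ l))
  | _, _, _, recvProc x P, Θ, Γ => ∃ s Δ, Γ x = some (.assume s Δ) ∧
      P.Der (Θ.ext ⟨s, Δ⟩) (Γ.erase x)
  | _, _, _, run p s ρ, Θ, Γ => ∃ Δ, Θ = empty.set p ⟨s, Δ⟩ ∧
      Ren Ty.IsWhyNot ρ (fun l => some (Δ l)) Γ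
  | _, _, _, close x, Θ, Γ => Θ = empty ∧ Γ x = some .one ∧
      (∀ c B, c ≠ x → Γ c = some B → B.IsWhyNot)
  | _, _, _, wait x P, Θ, Γ => Γ x = some .bot ∧ P.Der Θ (Γ.erase x)
  | _, _, _, emptyOffer x, Θ, Γ => Θ = empty ∧ Γ x = some .top
  | _, _, _, link x y A, Θ, Γ => Θ = empty ∧ Γ x = some A.dual ∧ Γ y = some A ∧
      (∀ c B, c ≠ x → c ≠ y → Γ c = some B → B.IsWhyNot)
  | _, _, _, cut A P Q, Θ, Γ => ∃ Θ₁ Θ₂ Γ₁ Γ₂, Θ.Split Θ₁ Θ₂ ∧ Join Ty.IsWhyNot Γ Γ₁ Γ₂ ∧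
      P.Der Θ₁ (Γ₁.ext A) ∧ Q.Der Θ₂ (Γ₂.ext A.dual)
  | _, _, _, chop Q s P, Θ, Γ => ∃ Δ Θ₁ Θ₂, Θ.Split Θ₁ Θ₂ ∧ P.Der Θ₁ (fun l => some (Δ l)) ∧
      Q.Der (Θ₂.ext ⟨s, Δ⟩) Γ

end Proc

theorem Ctx.Ren.allWhyNot {C C' T : Type} {f : C → C'} {Γ : Env C T} {Γ' : Env C' T}
    (h : Ren Ty.IsWhyNot f Γ Γ') {x : C} (hx : ∀ c B, c ≠ x → Γ c = some B → B.IsWhyNot) :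
    ∀ c B, c ≠ f x → Γ' c = some B → B.IsWhyNot := by
  intro c B hc hB
  rcases h.new c B hB with h1 | ⟨d, rfl, h1⟩
  · exact h1
  · exact hx d B (by grind) h1

/-- The delicate names are those `c ≠ x` with `f c = f x`: they have been contracted with `x`, so
their type is a `?`-type anyway. -/
theorem Ctx.Res.of_allWhyNot {C C' T : Type} {f : C → C'} {Γ : Env C T} {Γ' : Env C' T}
    (h : Res Ty.IsWhyNot f Γ Γ') {x : C} (hx : ∀ c B, c ≠ f x → Γ' c = some B → B.IsWhyNot) :
    ∀ c B, c ≠ x → Γ c = some B → B.IsWhyNot := by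
  intro c B hc hB
  have h1 := h.lin c x B
  have h2 := h.eq c
  have h3 := h.eq x
  grind

theorem Ctx.Ren.shift {C C' T : Type} {f : C → C'} {Γ : Env C T} {Γ' : Env C' T}
    (h : Ren Ty.IsWhyNot f Γ Γ') :
    Ren Ty.IsWhyNot f (Γ.map Ty.shift) (Γ'.map Ty.shift) :=
  h.map fun _ => Ty.IsWhyNot.shift

/-! ### Derivations are preserved and reflected by renaming -/

namespace Proc

/-- Weakening and contraction are both admissible in `Der`, by one induction on the process. The
principal channel of every construct but a link, `run` and a request has a type other than `?`, so
it is not contracted and its declaration can be updated along the renaming. A request only adds a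
name to its environment, so it needs no such condition. -/
theorem Der.rename {C C' V V' T : Type} {P : Proc C V T} {f : C → C'} {g : V → V'}
    {Θ : PEnv V T} {Θ' : PEnv V' T} {Γ : Env C T} {Γ' : Env C' T} (hg : VRen g Θ Θ')
    (hf : Ren Ty.IsWhyNot f Γ Γ') (h : P.Der Θ Γ) : (P.rename f g).Der Θ' Γ' := by
  induction P generalizing C' V' with
  | send x P Q ihP ihQ =>
    obtain ⟨A, B, Θ₁, Θ₂, Γ₁, Γ₂, hΘ, hx, hj, hP, hQ⟩ := h
    obtain ⟨Γ₁', Γ₂', hj', h1, h2⟩ := (hf.erase hx (by simp [Ty.IsWhyNot])).join hj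
    obtain ⟨Θ₁', Θ₂', hΘ', h3, h4⟩ := hg.split hΘ
    have hx2 := hj x
    have hx2' := hj' (f x)
    exact ⟨A, B, _, _, _, _, hΘ', hf.pres _ _ hx, hj', ihP h3 (h1.ext _) hP,
      ihQ h4 (h2.insert (by grind) _) hQ⟩
  | recv x P ih =>
    obtain ⟨A, B, hx, hP⟩ := h
    exact ⟨A, B, hf.pres _ _ hx, ih hg ((hf.set hx (by simp [Ty.IsWhyNot]) _).ext _) hP⟩
  | selL x P ih =>
    obtain ⟨A, B, hx, hP⟩ := h
    exact ⟨A, B, hf.pres _ _ hx, ih hg (hf.set hx (by simp [Ty.IsWhyNot]) _) hP⟩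
  | selR x P ih =>
    obtain ⟨A, B, hx, hP⟩ := h
    exact ⟨A, B, hf.pres _ _ hx, ih hg (hf.set hx (by simp [Ty.IsWhyNot]) _) hP⟩
  | offer x P Q ihP ihQ =>
    obtain ⟨A, B, hx, hP, hQ⟩ := h
    exact ⟨A, B, hf.pres _ _ hx, ihP hg (hf.set hx (by simp [Ty.IsWhyNot]) _) hP,
      ihQ hg (hf.set hx (by simp [Ty.IsWhyNot]) _) hQ⟩
  | client x P ih =>
    obtain ⟨A, hx, hP⟩ := h
    exact ⟨A, hf.pres _ _ hx, ih hg (hf.ext _) hP⟩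
  | server x P ih =>
    obtain ⟨A, hx, rfl, hw, hP⟩ := h
    obtain rfl := hg.eq_empty
    exact ⟨A, hf.pres _ _ hx, rfl, hf.allWhyNot hw,
      ih hg ((hf.erase hx (by simp [Ty.IsWhyNot])).ext _) hP⟩
  | sendTy x A P ih =>
    obtain ⟨B, hx, hP⟩ := h
    exact ⟨B, hf.pres _ _ hx, ih hg (hf.set hx (by simp [Ty.IsWhyNot]) _) hP⟩
  | recvTy x P ih =>
    obtain ⟨B, hx, hP⟩ := h
    refine ⟨B, hf.pres _ _ hx, ih (hg.map (φ := PTy.shift) fun _ h => h)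
      (hf.shift.set (x := x) (A := Ty.shift (.all B)) ?_ ?_ _) hP⟩
    · simp [Ctx.map, hx]
    · simp [Ty.IsWhyNot, Ty.shift, Ty.rename]
  | sendProc x s P ih =>
    obtain ⟨Δ, hx, hw, hP⟩ := h
    exact ⟨Δ, hf.pres _ _ hx, hf.allWhyNot hw, ih hg (.refl _) hP⟩
  | recvProc x P ih =>
    obtain ⟨s, Δ, hx, hP⟩ := h
    exact ⟨s, Δ, hf.pres _ _ hx, ih (hg.ext _) (hf.erase hx (by simp [Ty.IsWhyNot])) hP⟩
  | run p s ρ =>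
    obtain ⟨Δ, rfl, hρ⟩ := h
    refine ⟨Δ, ?_, hρ.comp hf⟩
    obtain ⟨h1, h2⟩ := hg.eq_set rfl
    rw [h1, h2.eq_empty]
  | close x =>
    obtain ⟨rfl, hx, hw⟩ := h
    exact ⟨hg.eq_empty, hf.pres _ _ hx, hf.allWhyNot hw⟩
  | wait x P ih =>
    obtain ⟨hx, hP⟩ := h
    exact ⟨hf.pres _ _ hx, ih hg (hf.erase hx (by simp [Ty.IsWhyNot])) hP⟩
  | emptyOffer x =>
    obtain ⟨rfl, hx⟩ := h
    exact ⟨hg.eq_empty, hf.pres _ _ hx⟩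
  | link x y A =>
    obtain ⟨rfl, hx, hy, hw⟩ := h
    refine ⟨hg.eq_empty, hf.pres _ _ hx, hf.pres _ _ hy, fun c B hcx hcy hB => ?_⟩
    rcases hf.new c B hB with h1 | ⟨d, rfl, h1⟩
    · exact h1
    · exact hw d B (by grind) (by grind) h1
  | cut A P Q ihP ihQ =>
    obtain ⟨Θ₁, Θ₂, Γ₁, Γ₂, hΘ, hj, hP, hQ⟩ := h
    obtain ⟨Γ₁', Γ₂', hj', h1, h2⟩ := hf.join hj
    obtain ⟨Θ₁', Θ₂', hΘ', h3, h4⟩ := hg.split hΘ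
    exact ⟨_, _, _, _, hΘ', hj', ihP h3 (h1.ext _) hP, ihQ h4 (h2.ext _) hQ⟩
  | chop Q s P ihQ ihP =>
    obtain ⟨Δ, Θ₁, Θ₂, hΘ, hP, hQ⟩ := h
    obtain ⟨Θ₁', Θ₂', hΘ', h3, h4⟩ := hg.split hΘ
    exact ⟨Δ, _, _, hΘ', ihP h3 (.refl _) hP, ihQ (h4.ext _) hf hQ⟩

/-- This needs `Res` and not just `Ren`: every name over a declared name must itself be declared, as
it may be the one that `P` uses. Applied to `some`, it strengthens away a name that does not occur;
applied to `Option.join`, it undoes a contraction. -/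
theorem Der.of_rename {C C' V V' T : Type} {P : Proc C V T} {f : C → C'} {g : V → V'}
    {Θ : PEnv V T} {Θ' : PEnv V' T} {Γ : Env C T} {Γ' : Env C' T}
    (hg : Res (fun _ => False) g Θ Θ')
    (hf : Res Ty.IsWhyNot f Γ Γ') (h : (P.rename f g).Der Θ' Γ') : P.Der Θ Γ := by
  induction P generalizing C' V' with
  | send x P Q ihP ihQ =>
    obtain ⟨A, B, Θ₁, Θ₂, Γ₁, Γ₂, hΘ, hx, hj, hP, hQ⟩ := h
    rw [hf.eq] at hx
    obtain ⟨Γ₁', Γ₂', hj', h1, h2⟩ := (hf.erase hx (by simp [Ty.IsWhyNot])).join hj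
    obtain ⟨Θ₁', Θ₂', hΘ', h3, h4⟩ := hg.split hΘ
    have hx2 := hj (f x)
    have hx2' := hj' x
    have hlin := hf.lin x
    refine ⟨A, B, _, _, _, _, hΘ', hx, hj', ihP h3 (h1.ext _) hP,
      ihQ h4 ⟨h2.insert (by grind) _, fun c => ?_⟩ hQ⟩
    -- A further name `c` over `f x` would be declared with the tensor type of `x`, which cannot be
    -- contracted; hence `c = x`.
    have hc := hlin c (.tensor A B)
    have h7 := hf.eq x
    have hl : ¬ (Ty.tensor A B).IsWhyNot := by simp [Ty.IsWhyNot]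
    have h5 := h2.eq c
    have h6 := hf.eq c
    clear ihP ihQ
    grind
  | recv x P ih =>
    obtain ⟨A, B, hx, hP⟩ := h
    rw [hf.eq] at hx
    exact ⟨A, B, hx, ih hg ((hf.set hx (by simp [Ty.IsWhyNot]) _).ext _) hP⟩
  | selL x P ih =>
    obtain ⟨A, B, hx, hP⟩ := h
    rw [hf.eq] at hx
    exact ⟨A, B, hx, ih hg (hf.set hx (by simp [Ty.IsWhyNot]) _) hP⟩
  | selR x P ih =>
    obtain ⟨A, B, hx, hP⟩ := h
    rw [hf.eq] at hx
    exact ⟨A, B, hx, ih hg (hf.set hx (by simp [Ty.IsWhyNot]) _) hP⟩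
  | offer x P Q ihP ihQ =>
    obtain ⟨A, B, hx, hP, hQ⟩ := h
    rw [hf.eq] at hx
    exact ⟨A, B, hx, ihP hg (hf.set hx (by simp [Ty.IsWhyNot]) _) hP,
      ihQ hg (hf.set hx (by simp [Ty.IsWhyNot]) _) hQ⟩
  | client x P ih =>
    obtain ⟨A, hx, hP⟩ := h
    rw [hf.eq] at hx
    exact ⟨A, hx, ih hg (hf.ext _) hP⟩
  | server x P ih =>
    obtain ⟨A, hx, rfl, hw, hP⟩ := h
    rw [hf.eq] at hx
    obtain rfl := hg.eq_empty
    exact ⟨A, hx, rfl, hf.of_allWhyNot hw,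
      ih hg ((hf.erase hx (by simp [Ty.IsWhyNot])).ext _) hP⟩
  | sendTy x A P ih =>
    obtain ⟨B, hx, hP⟩ := h
    rw [hf.eq] at hx
    exact ⟨B, hx, ih hg (hf.set hx (by simp [Ty.IsWhyNot]) _) hP⟩
  | recvTy x P ih =>
    obtain ⟨B, hx, hP⟩ := h
    rw [hf.eq] at hx
    refine ⟨B, hx, ih (hg.map (φ := PTy.shift) fun _ h => h)
      ((hf.map fun _ => Ty.IsWhyNot.shift).set (x := x) (A := Ty.shift (.all B)) ?_ ?_ _) hP⟩
    · simp [Ctx.map, hx]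
    · simp [Ty.IsWhyNot, Ty.shift, Ty.rename]
  | sendProc x s P ih =>
    obtain ⟨Δ, hx, hw, hP⟩ := h
    rw [hf.eq] at hx
    exact ⟨Δ, hx, hf.of_allWhyNot hw, ih hg (.refl _) hP⟩
  | recvProc x P ih =>
    obtain ⟨s, Δ, hx, hP⟩ := h
    rw [hf.eq] at hx
    exact ⟨s, Δ, hx, ih (hg.ext _) (hf.erase hx (by simp [Ty.IsWhyNot])) hP⟩
  | run p s ρ =>
    obtain ⟨Δ, rfl, hρ⟩ := h
    refine ⟨Δ, funext fun q => ?_, fun c A hc => ?_, fun c c' A hc => ?_, fun c A hc => ?_⟩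
    -- A variable `q` with `g q = g p` would be declared together with `p`, against the injectivity
    -- of `g` on declared variables unless `q = p`.
    · have hp := hg.eq p
      have h1 := hg.eq q
      have h2 := hg.lin p q
      grind
    · rw [← hf.eq]; exact hρ.pres c A hc
    · exact hρ.lin c c' A (congrArg f hc)
    · have := hf.eq c
      rcases hρ.new (f c) A (by grind) with h1 | ⟨l, hl, h1⟩
      · exact .inl h1
      · rcases hf.lin c (ρ l) A hl.symm hc (by rw [← hf.eq, hl, this, hc]; simp) with h2 | h2
        · exact .inr ⟨l, h2.symm, h1⟩
        · exact .inl h2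
  | close x =>
    obtain ⟨rfl, hx, hw⟩ := h
    rw [hf.eq] at hx
    exact ⟨hg.eq_empty, hx, hf.of_allWhyNot hw⟩
  | wait x P ih =>
    obtain ⟨hx, hP⟩ := h
    rw [hf.eq] at hx
    exact ⟨hx, ih hg (hf.erase hx (by simp [Ty.IsWhyNot])) hP⟩
  | emptyOffer x =>
    obtain ⟨rfl, hx⟩ := h
    rw [hf.eq] at hx
    exact ⟨hg.eq_empty, hx⟩
  | link x y A =>
    obtain ⟨rfl, hx, hy, hw⟩ := h
    rw [hf.eq] at hx hy
    refine ⟨hg.eq_empty, hx, hy, fun c B hcx hcy hB => ?_⟩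
    have h1 := hf.lin c x B
    have h2 := hf.lin c y B
    have h3 := hw (f c) B
    have h4 := hf.eq c
    grind
  | cut A P Q ihP ihQ =>
    obtain ⟨Θ₁, Θ₂, Γ₁, Γ₂, hΘ, hj, hP, hQ⟩ := h
    obtain ⟨Γ₁', Γ₂', hj', h1, h2⟩ := hf.join hj
    obtain ⟨Θ₁', Θ₂', hΘ', h3, h4⟩ := hg.split hΘ
    exact ⟨_, _, _, _, hΘ', hj', ihP h3 (h1.ext _) hP, ihQ h4 (h2.ext _) hQ⟩
  | chop Q s P ihQ ihP =>
    obtain ⟨Δ, Θ₁, Θ₂, hΘ, hP, hQ⟩ := h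
    obtain ⟨Θ₁', Θ₂', hΘ', h3, h4⟩ := hg.split hΘ
    exact ⟨Δ, _, _, hΘ', ihP h3 (.refl _) hP, ihQ (h4.ext _) hf hQ⟩

theorem Der.renC {C C' V T : Type} {P : Proc C V T} {f : C → C'} {Θ : PEnv V T} {Γ : Env C T}
    {Γ' : Env C' T} (h : P.Der Θ Γ) (hf : Ren Ty.IsWhyNot f Γ Γ') : (P.renC f).Der Θ Γ' :=
  h.rename (.refl _) hf

theorem Der.of_renC {C C' V T : Type} {P : Proc C V T} {f : C → C'} {Θ : PEnv V T} {Γ : Env C T}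
    {Γ' : Env C' T} (h : (P.renC f).Der Θ Γ') (hf : Res Ty.IsWhyNot f Γ Γ') : P.Der Θ Γ :=
  h.of_rename (.refl _) hf

theorem Der.renV {C V V' T : Type} {P : Proc C V T} {g : V → V'} {Θ : PEnv V T} {Γ : Env C T}
    {Θ' : PEnv V' T} (h : P.Der Θ Γ) (hg : VRen g Θ Θ') : (P.renV g).Der Θ' Γ :=
  h.rename hg (.refl _)

theorem Der.of_renV {C V V' T : Type} {P : Proc C V T} {g : V → V'} {Θ : PEnv V T} {Γ : Env C T}
    {Θ' : PEnv V' T} (h : (P.renV g).Der Θ' Γ) (hg : Res (fun _ => False) g Θ Θ') : P.Der Θ Γ :=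
  h.of_rename hg (.refl _)

theorem Der.weaken {C V T : Type} {P : Proc C V T} {Θ : PEnv V T} {Γ Γ' : Env C T}
    (h : P.Der Θ Γ) (hΓ : Ren Ty.IsWhyNot id Γ Γ') : P.Der Θ Γ' := by
  simpa using h.rename (.refl _) hΓ

end Proc

/-- Substitution of types in a process type. -/
def PTy.subst {T T' : Type} (σ : T → Ty T') (Δ : PTy T) : PTy T' :=
  ⟨Δ.dom, fun l => (Δ.ty l).subst σ⟩

theorem PTy.shift_subst_lift {T T' : Type} (σ : T → Ty T') (Δ : PTy T) :
    Δ.shift.subst (Ty.lift σ) = (Δ.subst σ).shift := by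
  simp [PTy.shift, PTy.subst, Ty.shift_subst_lift]

/-! ### Finite environments -/

namespace Ctx

variable {N N' : Type} {α β : Type 1} {W : α → Prop}

theorem map_map {γ : Type 1} (φ : α → β) (ψ : β → γ) (Γ : Ctx N α) :
    (Γ.map φ).map ψ = Γ.map (fun A => ψ (φ A)) := by
  funext n; simp [map, Function.comp_def]

theorem map_id' {φ : α → α} (h : ∀ A, φ A = A) (Γ : Ctx N α) : Γ.map φ = Γ := by
  funext n; cases hn : Γ n <;> simp [map, hn, h]

/-- The environment declares only finitely many names. -/
def Finite (Γ : Ctx N α) : Prop := {c | Γ c ≠ none}.Finite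

theorem Finite.of_le {Γ : Ctx N α} {Γ' : Ctx N β} (h : Γ.Finite)
    (hle : ∀ c, Γ' c ≠ none → Γ c ≠ none) : Γ'.Finite := Set.Finite.subset h hle

theorem Finite.erase {Γ : Ctx N α} (h : Γ.Finite) (x : N) : (Γ.erase x).Finite :=
  h.of_le fun c => by grind

theorem Finite.set {Γ : Ctx N α} (h : Γ.Finite) (x : N) (A : α) : (Γ.set x A).Finite :=
  (Set.Finite.insert x h).subset fun c => by
    simp only [Set.mem_ofPred_eq, Set.mem_insert_iff]; grind

theorem Finite.of_set {Γ : Ctx N α} {x : N} {A : α} (h : (Γ.set x A).Finite) : Γ.Finite :=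
  h.of_le fun c => by grind

theorem Finite.ext {Γ : Ctx N α} (h : Γ.Finite) (A : α) : (Γ.ext A).Finite := by
  refine ((Set.Finite.image some h).insert none).subset fun c hc => ?_
  cases c with
  | none => exact .inl rfl
  | some c => exact .inr ⟨c, hc, rfl⟩

theorem Finite.of_ext {Γ : Ctx N α} {A : α} (h : (Γ.ext A).Finite) : Γ.Finite :=
  Set.Finite.preimage (f := some) (Option.some_injective _).injOn h

theorem Finite.map {Γ : Ctx N α} (h : Γ.Finite) (φ : α → β) : (Γ.map φ).Finite :=
  h.of_le fun c => by simp [Ctx.map]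

theorem Finite.of_map {Γ : Ctx N α} {φ : α → β} (h : (Γ.map φ).Finite) : Γ.Finite :=
  h.of_le fun c => by simp [Ctx.map]

theorem Finite.of_ren {f : N → N'} {Γ : Ctx N α} {Γ' : Ctx N' α} (h : Γ.Finite)
    (hf : Ren (fun _ => False) f Γ Γ') : Γ'.Finite := by
  refine (Set.Finite.image f h).subset fun c hc => ?_
  obtain ⟨A, hA⟩ := Option.ne_none_iff_exists'.1 hc
  obtain ⟨d, rfl, hd⟩ := (hf.new c A hA).resolve_left id
  exact ⟨d, by simp [hd], rfl⟩

theorem Join.finite_left {Γ Γ₁ Γ₂ : Ctx N α} (h : Join W Γ Γ₁ Γ₂) (hΓ : Γ.Finite) : Γ₁.Finite :=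
  hΓ.of_le fun c => by have := h c; grind

theorem Join.finite_right {Γ Γ₁ Γ₂ : Ctx N α} (h : Join W Γ Γ₁ Γ₂) (hΓ : Γ.Finite) :
    Γ₂.Finite := h.symm.finite_left hΓ

theorem Split.finite {Γ Γ₁ Γ₂ : Ctx N α} (h : Γ.Split Γ₁ Γ₂) (h₁ : Γ₁.Finite)
    (h₂ : Γ₂.Finite) : Γ.Finite :=
  (Set.Finite.union h₁ h₂).subset fun c => by
    have := h c
    simp only [Set.mem_ofPred_eq, Set.mem_union]; grind

end Ctx

/-! ### Type substitution and free names in derivations -/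

namespace Proc

/-- All side conditions of `Der` are positive in "being a `?`-type", a property that substitution
preserves though it does not reflect it. -/
theorem Der.tsubst {C V T T' : Type} {P : Proc C V T} {σ : T → Ty T'} {Θ : PEnv V T}
    {Γ : Env C T} (h : P.Der Θ Γ) :
    (P.tsubst σ).Der (Θ.map (PTy.subst σ)) (Γ.map (Ty.subst σ)) := by
  induction P generalizing T' with
  | send x P Q ihP ihQ =>
    obtain ⟨A, B, Θ₁, Θ₂, Γ₁, Γ₂, hΘ, hx, hj, hP, hQ⟩ := h
    have hj' := hj.map (φ := Ty.subst σ) fun _ => Ty.IsWhyNot.subst σ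
    refine ⟨A.subst σ, B.subst σ, _, _, _, _, hΘ.map, by simp [map, hx, Ty.subst],
      by simpa using hj', ?_, ?_⟩
    · simpa using ihP (σ := σ) hP
    · simpa using ihQ (σ := σ) hQ
  | recv x P ih =>
    obtain ⟨A, B, hx, hP⟩ := h
    exact ⟨A.subst σ, B.subst σ, by simp [map, hx, Ty.subst], by simpa using ih (σ := σ) hP⟩
  | selL x P ih =>
    obtain ⟨A, B, hx, hP⟩ := h
    exact ⟨A.subst σ, B.subst σ, by simp [map, hx, Ty.subst], by simpa using ih (σ := σ) hP⟩
  | selR x P ih =>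
    obtain ⟨A, B, hx, hP⟩ := h
    exact ⟨A.subst σ, B.subst σ, by simp [map, hx, Ty.subst], by simpa using ih (σ := σ) hP⟩
  | offer x P Q ihP ihQ =>
    obtain ⟨A, B, hx, hP, hQ⟩ := h
    exact ⟨A.subst σ, B.subst σ, by simp [map, hx, Ty.subst], by simpa using ihP (σ := σ) hP,
      by simpa using ihQ (σ := σ) hQ⟩
  | client x P ih =>
    obtain ⟨A, hx, hP⟩ := h
    exact ⟨A.subst σ, by simp [map, hx, Ty.subst], by simpa using ih (σ := σ) hP⟩
  | server x P ih =>
    obtain ⟨A, hx, rfl, hw, hP⟩ := h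
    refine ⟨A.subst σ, by simp [map, hx, Ty.subst], by simp, fun c B hc hB => ?_,
      by simpa using ih (σ := σ) hP⟩
    obtain ⟨D, hD, rfl⟩ := Option.map_eq_some_iff.1 hB
    exact (hw c D hc hD).subst σ
  | sendTy x A P ih =>
    obtain ⟨B, hx, hP⟩ := h
    refine ⟨B.subst (Ty.lift σ), by simp [map, hx, Ty.subst], ?_⟩
    rw [← Ty.subst_single_subst]
    simpa using ih (σ := σ) hP
  | recvTy x P ih =>
    obtain ⟨B, hx, hP⟩ := h
    refine ⟨B.subst (Ty.lift σ), by simp [map, hx, Ty.subst], ?_⟩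
    have := ih (σ := Ty.lift σ) hP
    simpa only [map_set, map_map, Ty.shift_subst_lift, PTy.shift_subst_lift] using this
  | sendProc x s P ih =>
    obtain ⟨Δ, hx, hw, hP⟩ := h
    refine ⟨fun l => (Δ l).subst σ, by simp [map, hx, Ty.subst], fun c B hc hB => ?_,
      ih (σ := σ) hP⟩
    obtain ⟨D, hD, rfl⟩ := Option.map_eq_some_iff.1 hB
    exact (hw c D hc hD).subst σ
  | recvProc x P ih =>
    obtain ⟨s, Δ, hx, hP⟩ := h
    refine ⟨s, fun l => (Δ l).subst σ, by simp [map, hx, Ty.subst], ?_⟩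
    have := ih (σ := σ) hP
    rw [map_ext, map_erase] at this
    exact this
  | run p s ρ =>
    obtain ⟨Δ, rfl, hρ⟩ := h
    exact ⟨fun l => (Δ l).subst σ, by rw [map_set]; rfl,
      hρ.map (φ := Ty.subst σ) fun _ => Ty.IsWhyNot.subst σ⟩
  | close x =>
    obtain ⟨rfl, hx, hw⟩ := h
    refine ⟨rfl, by simp [map, hx, Ty.subst], fun c B hc hB => ?_⟩
    obtain ⟨D, hD, rfl⟩ := Option.map_eq_some_iff.1 hB
    exact (hw c D hc hD).subst σ
  | wait x P ih =>
    obtain ⟨hx, hP⟩ := h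
    exact ⟨by simp [map, hx, Ty.subst], by simpa using ih (σ := σ) hP⟩
  | emptyOffer x =>
    obtain ⟨rfl, hx⟩ := h
    exact ⟨rfl, by simp [map, hx, Ty.subst]⟩
  | link x y A =>
    obtain ⟨rfl, hx, hy, hw⟩ := h
    refine ⟨rfl, by simp [map, hx, Ty.subst_dual], by simp [map, hy], fun c B hc hc' hB => ?_⟩
    obtain ⟨D, hD, rfl⟩ := Option.map_eq_some_iff.1 hB
    exact (hw c D hc hc' hD).subst σ
  | cut A P Q ihP ihQ =>
    obtain ⟨Θ₁, Θ₂, Γ₁, Γ₂, hΘ, hj, hP, hQ⟩ := h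
    refine ⟨_, _, _, _, hΘ.map, hj.map (φ := Ty.subst σ) fun _ => Ty.IsWhyNot.subst σ, ?_, ?_⟩
    · simpa using ihP (σ := σ) hP
    · simpa [Ty.subst_dual] using ihQ (σ := σ) hQ
  | chop Q s P ihQ ihP =>
    obtain ⟨Δ, Θ₁, Θ₂, hΘ, hP, hQ⟩ := h
    refine ⟨fun l => (Δ l).subst σ, _, _, hΘ.map, ihP (σ := σ) hP, ?_⟩
    have := ihQ (σ := σ) hQ
    rw [map_ext] at this
    exact this

theorem Der.tshift {C V T : Type} {P : Proc C V T} {Θ : PEnv V T} {Γ : Env C T}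
    (h : P.Der Θ Γ) : P.tshift.Der (Θ.map PTy.shift) (Γ.map Ty.shift) := by
  have h1 : (Ty.shift : Ty T → _) = Ty.subst (fun X => .tvar (some X)) :=
    funext Ty.shift_eq_subst
  have h2 : (PTy.shift : PTy T → _) = PTy.subst (fun X => .tvar (some X)) := by
    funext Δ; simp [PTy.shift, PTy.subst, Ty.shift_eq_subst]
  rw [h1, h2]
  exact h.tsubst

/-- The converse fails: leaves absorb unused `?`-channels and `x.case()` absorbs channels of any
type. This is why the equivalence for nested cuts and the conversions for outputs ask that a name be
free in a given component. -/
theorem Der.ne_none_of_mem_fc {C V T : Type} {P : Proc C V T} {Θ : PEnv V T} {Γ : Env C T}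
    (h : P.Der Θ Γ) {c : C} (hc : c ∈ P.fc) : Γ c ≠ none := by
  induction P with
  | send x P Q ihP ihQ =>
    obtain ⟨A, B, Θ₁, Θ₂, Γ₁, Γ₂, hΘ, hx, hj, hP, hQ⟩ := h
    have h1 := ihP hP (c := some c)
    have h2 := ihQ hQ (c := c)
    have := hj c
    simp only [fc, Set.mem_union, Set.mem_singleton_iff, Set.mem_preimage] at hc
    grind
  | recv x P ih =>
    obtain ⟨A, B, hx, hP⟩ := h
    have h1 := ih hP (c := some c)
    simp only [fc, Set.mem_union, Set.mem_singleton_iff, Set.mem_preimage] at hc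
    grind
  | selL x P ih | selR x P ih =>
    obtain ⟨A, B, hx, hP⟩ := h
    have h1 := ih hP (c := c)
    simp only [fc, Set.mem_union, Set.mem_singleton_iff] at hc
    grind
  | offer x P Q ihP ihQ =>
    obtain ⟨A, B, hx, hP, hQ⟩ := h
    have h1 := ihP hP (c := c)
    have h2 := ihQ hQ (c := c)
    simp only [fc, Set.mem_union, Set.mem_singleton_iff] at hc
    grind
  | client x P ih =>
    obtain ⟨A, hx, hP⟩ := h
    have h1 := ih hP (c := some c)
    simp only [fc, Set.mem_union, Set.mem_singleton_iff, Set.mem_preimage] at hc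
    grind
  | server x P ih =>
    obtain ⟨A, hx, rfl, hw, hP⟩ := h
    have h1 := ih hP (c := some c)
    simp only [fc, Set.mem_union, Set.mem_singleton_iff, Set.mem_preimage] at hc
    grind
  | sendTy x A P ih =>
    obtain ⟨B, hx, hP⟩ := h
    have h1 := ih hP (c := c)
    simp only [fc, Set.mem_union, Set.mem_singleton_iff] at hc
    grind
  | recvTy x P ih =>
    obtain ⟨B, hx, hP⟩ := h
    have h1 := ih hP (c := c)
    simp only [fc, Set.mem_union, Set.mem_singleton_iff] at hc
    rcases hn : Γ c with _ | D <;> simp only [set_apply, Ctx.map] at h1 <;> grind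
  | sendProc x s P ih =>
    obtain ⟨Δ, hx, hw, hP⟩ := h
    rw [show c = x from hc, hx]; simp
  | recvProc x P ih =>
    obtain ⟨s, Δ, hx, hP⟩ := h
    have h1 := ih hP (c := c)
    simp only [fc, Set.mem_union, Set.mem_singleton_iff] at hc
    grind
  | run p s ρ =>
    obtain ⟨Δ, rfl, hρ⟩ := h
    obtain ⟨l, rfl⟩ := hc
    simp [hρ.pres l _ rfl]
  | close x =>
    rw [show c = x from hc, h.2.1]; simp
  | wait x P ih =>
    obtain ⟨hx, hP⟩ := h
    have h1 := ih hP (c := c)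
    simp only [fc, Set.mem_union, Set.mem_singleton_iff] at hc
    grind
  | emptyOffer x =>
    rw [show c = x from hc, h.2]; simp
  | link x y A =>
    obtain ⟨rfl, hx, hy, hw⟩ := h
    rcases hc with rfl | rfl <;> simp [*]
  | cut A P Q ihP ihQ =>
    obtain ⟨Θ₁, Θ₂, Γ₁, Γ₂, hΘ, hj, hP, hQ⟩ := h
    have h1 := ihP hP (c := some c)
    have h2 := ihQ hQ (c := some c)
    have := hj c
    simp only [fc, Set.mem_union, Set.mem_preimage] at hc
    grind
  | chop Q s P ihQ ihP =>
    obtain ⟨Δ, Θ₁, Θ₂, hΘ, hP, hQ⟩ := h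
    exact ihQ hQ hc

/-- Process variables are linear: no leaf, not even `x.case()`, may leave one unused, so both
directions hold. -/
theorem Der.mem_fv_iff {C V T : Type} {P : Proc C V T} {Θ : PEnv V T} {Γ : Env C T}
    (h : P.Der Θ Γ) (v : V) : v ∈ P.fv ↔ Θ v ≠ none := by
  induction P with
  | send x P Q ihP ihQ =>
    obtain ⟨A, B, Θ₁, Θ₂, Γ₁, Γ₂, hΘ, hx, hj, hP, hQ⟩ := h
    have := hΘ v
    simp only [fv, Set.mem_union, ihP hP, ihQ hQ]
    grind
  | recv x P ih | selL x P ih | selR x P ih =>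
    obtain ⟨A, B, hx, hP⟩ := h
    exact ih hP v
  | offer x P Q ihP ihQ =>
    obtain ⟨A, B, hx, hP, hQ⟩ := h
    simp only [fv, Set.mem_union, ihP hP, ihQ hQ, or_self]
  | client x P ih =>
    obtain ⟨A, hx, hP⟩ := h
    exact ih hP v
  | server x P ih =>
    obtain ⟨A, hx, rfl, hw, hP⟩ := h
    exact ih hP v
  | sendTy x A P ih =>
    obtain ⟨B, hx, hP⟩ := h
    exact ih hP v
  | recvTy x P ih =>
    obtain ⟨B, hx, hP⟩ := h
    rw [fv, ih hP v]
    simp [Ctx.map]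
  | sendProc x s P ih =>
    obtain ⟨Δ, hx, hw, hP⟩ := h
    exact ih hP v
  | recvProc x P ih =>
    obtain ⟨s, Δ, hx, hP⟩ := h
    exact ih hP (some v)
  | run p s ρ =>
    obtain ⟨Δ, rfl, hρ⟩ := h
    rw [fv, Set.mem_singleton_iff]
    grind
  | close x => simp [fv, h.1]
  | wait x P ih => exact ih h.2 v
  | emptyOffer x => simp [fv, h.1]
  | link x y A => simp [fv, h.1]
  | cut A P Q ihP ihQ =>
    obtain ⟨Θ₁, Θ₂, Γ₁, Γ₂, hΘ, hj, hP, hQ⟩ := h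
    have := hΘ v
    simp only [fv, Set.mem_union, ihP hP, ihQ hQ]
    grind
  | chop Q s P ihQ ihP =>
    obtain ⟨Δ, Θ₁, Θ₂, hΘ, hP, hQ⟩ := h
    have := hΘ v
    simp only [fv, Set.mem_union, Set.mem_preimage, ihP hP, ihQ hQ, ext_some]
    grind

end Proc

/-! ### From typing to derivations, and renaming of typings -/

namespace Typed

theorem finite {C V T : Type} {Θ : PEnv V T} {P : Proc C V T} {Γ : Env C T}
    (h : Typed Θ P Γ) : Ctx.Finite Γ := by
  have he : ∀ {C T : Type}, Ctx.Finite (Ctx.empty : Env C T) := by simp [Ctx.Finite]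
  induction h with
  | axiomLink hxy => exact (he.set _ _).set _ _
  | cut hΘ hΓ hP hQ ihP ihQ => exact hΓ.finite ihP.of_ext ihQ.of_ext
  | tensor hΘ hΓ hx hP hQ ihP ihQ => exact (hΓ.finite ihP.of_ext ihQ.of_set).set _ _
  | par hx hP ih => exact ih.of_ext.of_set.set _ _
  | plus₁ hx hP ih => exact ih.of_set.set _ _
  | plus₂ hx hP ih => exact ih.of_set.set _ _
  | whyNot hx hP ih => exact ih.of_ext.set _ _
  | ofCourse hx hΓ hP ih => exact ih.of_ext.set _ _
  | ex hx hP ih => exact ih.of_set.set _ _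
  | all hx hP ih => exact (Ctx.Finite.of_map (φ := Ty.shift) ih.of_set).set _ _
  | weaken hx hP ih => exact ih.set _ _
  | contract hx hP ih => exact ih.of_ext.of_ext.set _ _
  | one => exact he.set _ _
  | bot hx hP ih => exact ih.set _ _
  | top hx hfin => exact Ctx.Finite.set hfin _ _
  | @ident C V T p s Δ ρ Γ hρ hΓ hΓ' =>
    refine (Set.finite_range ρ).subset fun c hc => ?_
    by_contra hn
    exact hc (hΓ' c hn)
  | chop hΘ hP hQ ihP ihQ => exact ihQ
  | provide hP ih => exact he.set _ _
  | assume hx hP ih => exact ih.set _ _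
  -- The remaining case is the rule for `&`.
  | _ =>
    rename_i hx hP hQ ihP ihQ
    exact ihP.of_set.set _ _

/-- A disjoint split is a special join, and the two structural rules are instances of `Der.rename`.
-/
theorem der {C V T : Type} {Θ : PEnv V T} {P : Proc C V T} {Γ : Env C T}
    (h : Typed Θ P Γ) : P.Der Θ Γ := by
  induction h with
  | axiomLink hxy => exact ⟨rfl, by grind, by grind, by grind⟩
  | cut hΘ hΓ hP hQ ihP ihQ => exact ⟨_, _, _, _, hΘ, hΓ.join, ihP, ihQ⟩
  | tensor hΘ hΓ hx hP hQ ihP ihQ =>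
    exact ⟨_, _, _, _, _, _, hΘ, set_same _ _ _, by simpa [hx] using hΓ.join, ihP, ihQ⟩
  | par hx hP ih => exact ⟨_, _, set_same _ _ _, by simpa using ih⟩
  | plus₁ hx hP ih => exact ⟨_, _, set_same _ _ _, by simpa using ih⟩
  | plus₂ hx hP ih => exact ⟨_, _, set_same _ _ _, by simpa using ih⟩
  | @whyNot C V T Θ Γ x A P hx hP ih =>
    refine ⟨_, set_same _ _ _, ih.weaken ?_⟩
    -- In `Der` the continuation of a request still sees `x : ?A`, so the premise is first weakened
    -- by it.
    have : Ren Ty.IsWhyNot id Γ (Γ.set x (.whyNot A)) :=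
      ⟨by grind, fun c c' A h _ _ => .inl h, fun c B hc => by
        have : (Ty.whyNot A).IsWhyNot := ⟨_, rfl⟩
        grind⟩
    simpa using this.ext A
  | ofCourse hx hΓ hP ih =>
    exact ⟨_, set_same _ _ _, rfl, fun c B hc hB => hΓ c B (by grind), by simpa [hx] using ih⟩
  | ex hx hP ih => exact ⟨_, set_same _ _ _, by simpa using ih⟩
  | all hx hP ih =>
    refine ⟨_, set_same _ _ _, ?_⟩
    rw [map_set, set_set]
    exact ih
  | @weaken C V T Θ Γ x A P hx hP ih =>
    refine ih.weaken ⟨by grind, fun c c' A h _ _ => .inl h, fun c B hc => ?_⟩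
    have : (Ty.whyNot A).IsWhyNot := ⟨_, rfl⟩
    grind
  | @contract C V T Θ Γ x A P hx hP ih =>
    have : (Ty.whyNot A).IsWhyNot := ⟨_, rfl⟩
    refine ih.renC ⟨fun c B hc => ?_, fun c c' B hf hc hc' => ?_, fun c B hc => ?_⟩
    · rcases c with _ | _ | c <;> simp at hc ⊢ <;> grind
    · rcases c with _ | _ | c <;> rcases c' with _ | _ | c' <;> simp at hf hc hc' ⊢ <;> grind
    · by_cases h : c = x
      · grind
      · exact .inr ⟨some (some c), rfl, by simp; grind⟩
  | one => exact ⟨rfl, by simp, by grind⟩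
  | bot hx hP ih => exact ⟨set_same _ _ _, by simpa [hx] using ih⟩
  | top hx hfin => exact ⟨rfl, by simp⟩
  | @ident C V T p s Δ ρ Γ hρ hΓ hΓ' =>
    refine ⟨Δ, rfl, fun c A hc => ?_, fun c c' A h _ _ => .inl (hρ h), fun c A hc => ?_⟩
    · rw [hΓ, ← hc]
    · by_cases h : c ∈ Set.range ρ
      · obtain ⟨l, rfl⟩ := h
        exact .inr ⟨l, rfl, by rw [← hc, hΓ]⟩
      · rw [hΓ' c h] at hc; cases hc
  | chop hΘ hP hQ ihP ihQ => exact ⟨_, _, _, hΘ, ihP, ihQ⟩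
  | provide hP ih => exact ⟨_, set_same _ _ _, by grind, ih⟩
  | assume hx hP ih => exact ⟨_, _, set_same _ _ _, by simpa [hx] using ih⟩
  | _ =>
    rename_i hx hP hQ ihP ihQ
    exact ⟨_, _, set_same _ _ _, by simpa using ihP, by simpa using ihQ⟩

/-- The linear stage of `Typed.rename`: with nothing contracted or added, the renaming can be pushed
through every rule of the given derivation. -/
theorem rename_injective {C C' V T : Type} {Θ : PEnv V T} {P : Proc C V T} {Γ : Env C T}
    {f : C → C'} {Γ' : Env C' T} (h : Typed Θ P Γ) (hf : Ren (fun _ => False) f Γ Γ') :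
    Typed Θ (P.renC f) Γ' := by
  induction h generalizing C' with
  | @axiomLink C V T x y A hxy =>
    obtain ⟨h1, h2⟩ := hf.eq_set (by grind)
    obtain ⟨h3, h4⟩ := h2.eq_set rfl
    rw [h1, h3, h4.eq_empty]
    refine .axiomLink fun h => hxy ?_
    refine (hf.lin x y A.dual h (by grind) (by grind)).resolve_right id
  | cut hΘ hΓ hP hQ ihP ihQ =>
    obtain ⟨Γ₁', Γ₂', h1, h2, h3⟩ := hf.split hΓ
    exact .cut hΘ h1 (ihP (h2.ext _)) (ihQ (h3.ext _))
  | @tensor C V T Θ Θ₁ Θ₂ Γ Γ₁ Γ₂ x A B P Q hΘ hΓ hx hP hQ ihP ihQ =>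
    obtain ⟨h1, h2⟩ := hf.eq_set hx
    obtain ⟨Γ₁', Γ₂', h3, h4, h5⟩ := h2.split hΓ
    rw [h1]
    have := h3 (f x)
    exact .tensor hΘ h3 (by simp) (ihP (h4.ext _)) (ihQ (h5.insert (by grind) _))
  | par hx hP ih =>
    obtain ⟨h1, h2⟩ := hf.eq_set hx
    rw [h1]
    exact .par (by simp) (ih ((h2.insert (by simp) _).ext _))
  | plus₁ hx hP ih =>
    obtain ⟨h1, h2⟩ := hf.eq_set hx
    rw [h1]
    exact .plus₁ (by simp) (ih (h2.insert (by simp) _))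
  | plus₂ hx hP ih =>
    obtain ⟨h1, h2⟩ := hf.eq_set hx
    rw [h1]
    exact .plus₂ (by simp) (ih (h2.insert (by simp) _))
  | whyNot hx hP ih =>
    obtain ⟨h1, h2⟩ := hf.eq_set hx
    rw [h1]
    exact .whyNot (by simp) (ih (h2.ext _))
  | ofCourse hx hΓ hP ih =>
    obtain ⟨h1, h2⟩ := hf.eq_set hx
    rw [h1]
    refine .ofCourse (by simp) (fun c A hc => ?_) (ih (h2.ext _))
    obtain ⟨d, rfl, hd⟩ := (h2.new c A hc).resolve_left id
    exact hΓ d A hd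
  | ex hx hP ih =>
    obtain ⟨h1, h2⟩ := hf.eq_set hx
    rw [h1]
    exact .ex (by simp) (ih (h2.insert (by simp) _))
  | all hx hP ih =>
    obtain ⟨h1, h2⟩ := hf.eq_set hx
    rw [h1]
    exact .all (by simp) (ih ((h2.map (φ := Ty.shift) fun _ h => h).insert (by simp [Ctx.map]) _))
  | weaken hx hP ih =>
    obtain ⟨h1, h2⟩ := hf.eq_set hx
    rw [h1]
    exact .weaken (by simp) (ih h2)
  | @contract C V T Θ Γ x A P hx hP ih =>
    obtain ⟨h1, h2⟩ := hf.eq_set hx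
    have h3 := Typed.contract (x := f x) (by simp) (ih ((h2.ext _).ext _))
    rw [← h1, Proc.renC_renC] at h3
    rw [Proc.renC_renC]
    convert h3 using 2
    funext c
    rcases c with _ | _ | c <;> rfl
  | one =>
    obtain ⟨h1, h2⟩ := hf.eq_set rfl
    rw [h1, h2.eq_empty]
    exact .one
  | bot hx hP ih =>
    obtain ⟨h1, h2⟩ := hf.eq_set hx
    rw [h1]
    exact .bot (by simp) (ih h2)
  | top hx hfin =>
    obtain ⟨h1, h2⟩ := hf.eq_set hx
    rw [h1]
    exact .top (by simp) (Ctx.Finite.of_ren hfin h2)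
  | ident hρ hΓ hΓ' =>
    refine .ident (fun l l' h => hρ ((hf.lin _ _ _ h (hΓ l) (by simp [hΓ])).resolve_right id))
      (fun l => hf.pres _ _ (hΓ l)) fun c hc => ?_
    by_contra hn
    obtain ⟨A, hA⟩ := Option.ne_none_iff_exists'.1 hn
    obtain ⟨d, rfl, hd⟩ := (hf.new c A hA).resolve_left id
    rw [hΓ' d fun ⟨l, hl⟩ => hc ⟨l, by simp [hl]⟩] at hd
    cases hd
  | chop hΘ hP hQ ihP ihQ =>
    refine .chop hΘ (by simpa using hP) ?_
    simpa [Proc.renC] using ihQ hf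
  | provide hP ih =>
    obtain ⟨h1, h2⟩ := hf.eq_set rfl
    rw [h1, h2.eq_empty]
    exact .provide (by simpa using hP)
  | assume hx hP ih =>
    obtain ⟨h1, h2⟩ := hf.eq_set hx
    rw [h1]
    refine .assume (by simp) ?_
    simpa [Proc.renC] using ih h2
  | _ =>
    rename_i hx hP hQ ihP ihQ
    obtain ⟨h1, h2⟩ := hf.eq_set hx
    rw [h1]
    exact .with (by simp) (ihP (h2.insert (by simp) _)) (ihQ (h2.insert (by simp) _))

/-- One use of weakening for each missing name, by induction on their number; this is where
finiteness is indispensable. -/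
theorem weaken_finite {C V T : Type} {Θ : PEnv V T} {P : Proc C V T} {Γ Γ' : Env C T}
    (h : Typed Θ P Γ) (hΓ : Ren Ty.IsWhyNot id Γ Γ') (hfin : Ctx.Finite Γ') :
    Typed Θ P Γ' := by
  have hfin' : {c | Γ c = none ∧ Γ' c ≠ none}.Finite := Set.Finite.subset hfin fun c hc => hc.2
  induction hn : {c | Γ c = none ∧ Γ' c ≠ none}.ncard generalizing Γ with
  | zero =>
    rw [Set.ncard_eq_zero hfin'] at hn
    convert h using 1
    funext c
    rcases hc : Γ c with _ | A
    · by_contra hc'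
      exact (hn ▸ (⟨hc, hc'⟩ : c ∈ {c | Γ c = none ∧ Γ' c ≠ none}) : c ∈ (∅ : Set C))
    · exact hΓ.pres c A hc
  | succ n ih =>
    obtain ⟨c, hc, hc'⟩ := (Set.ncard_pos hfin').1 (hn ▸ n.succ_pos)
    obtain ⟨B, hB⟩ := Option.ne_none_iff_exists'.1 hc'
    have hW : B.IsWhyNot := (hΓ.new c B hB).resolve_right fun ⟨d, hd, hd'⟩ => by
      obtain rfl : d = c := hd
      simp [hc] at hd'
    obtain ⟨A, rfl⟩ := hW
    have hs : {d | Γ.set c (.whyNot A) d = none ∧ Γ' d ≠ none} =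
        {c | Γ c = none ∧ Γ' c ≠ none} \ {c} := by
      ext d
      simp only [Set.mem_ofPred_eq, Set.mem_sdiff, Set.mem_singleton_iff]
      grind
    refine ih (h.weaken (x := c) (A := A) hc) ⟨fun d D hd => ?_, fun d d' D hd _ _ => .inl hd,
      fun d D hd => ?_⟩ (hs ▸ hfin'.sdiff) ?_
    · have := hΓ.pres d D
      simp only [id] at *
      grind
    · have := hΓ.new d D hd
      simp only [id] at *
      grind
    · rw [hs, Set.ncard_sdiff_singleton_of_mem
        (show c ∈ {c | Γ c = none ∧ Γ' c ≠ none} from ⟨hc, hc'⟩), hn]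
      rfl

-- Contraction of two arbitrary names. The rule only contracts the two innermost names, so `a` and
-- `b` are first moved there injectively; `a`, now undeclared, can then serve as the result.
open Classical in
theorem identify {C V T : Type} {Θ : PEnv V T} {P : Proc C V T} {Γ : Env C T} {a b : C}
    {A : Ty T} (h : Typed Θ P Γ) (hab : a ≠ b) (ha : Γ a = some (.whyNot A))
    (hb : Γ b = some (.whyNot A)) :
    Typed Θ (P.renC (fun c => if c = b then a else c)) (Ctx.erase Γ b) := by
  have h1 := h.rename_injective (f := fun c => if c = a then none else if c = b then some none
      else some (some c))
    (Γ' := (((Ctx.erase Γ a).erase b).ext (.whyNot A)).ext (.whyNot A))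
    ⟨fun c B hc => by grind, fun c c' B hf hc hc' => by grind, fun c B hc => .inr (by
      rcases c with _ | _ | c
      · exact ⟨a, by grind⟩
      · exact ⟨b, by grind⟩
      · exact ⟨c, by grind⟩)⟩
  have h2 := h1.contract (x := a) (by grind)
  rw [Proc.renC_renC] at h2
  convert h2 using 1
  · congr 1
    funext c
    by_cases hca : c = a
    · simp [hca]
    · by_cases hcb : c = b
      · simp [hcb, hab.symm]
      · simp [hca, hcb]
  · funext c
    grind

/-- Induction on the number of declared names. If two of them have the same image, they carry the
same `?`-type and can be contracted. Otherwise `f` is injective on the domain, and the renaming is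
an injective one followed by weakening. -/
theorem rename {C C' V T : Type} {Θ : PEnv V T} {P : Proc C V T} {Γ : Env C T} {f : C → C'}
    {Γ' : Env C' T} (h : Typed Θ P Γ) (hf : Ren Ty.IsWhyNot f Γ Γ')
    (hfin : Ctx.Finite Γ') : Typed Θ (P.renC f) Γ' := by
  classical
  induction hn : {c | Γ c ≠ none}.ncard using Nat.strong_induction_on generalizing P Γ with
  | _ n ih =>
    by_cases hinj : ∀ c c' A, f c = f c' → Γ c = some A → Γ c' ≠ none → c = c'
    -- The part of `Γ'` in the image of `Γ`; what is missing from it has only `?`-types.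
    · let Γ₀ : Env C' T := fun c' => if ∃ c, f c = c' ∧ Γ c ≠ none then Γ' c' else none
      have h0 : Ren (fun _ => False) f Γ Γ₀ := by
        refine ⟨fun c A hc => ?_, fun c c' A h hc hc' => .inl (hinj c c' A h hc hc'),
          fun c' A hc' => ?_⟩
        · exact (if_pos ⟨c, rfl, by simp [hc]⟩).trans (hf.pres c A hc)
        · simp only [Γ₀] at hc'
          split_ifs at hc' with hif
          obtain ⟨c, rfl, hc⟩ := hif
          obtain ⟨B, hB⟩ := Option.ne_none_iff_exists'.1 hc
          have := hf.pres c B hB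
          grind
      refine (h.rename_injective h0).weaken_finite ⟨fun c A hc => ?_, fun c c' A h _ _ => .inl h,
        fun c A hc => ?_⟩ hfin
      · simp only [Γ₀] at hc
        split_ifs at hc
        exact hc
      · rcases hf.new c A hc with h1 | ⟨d, rfl, hd⟩
        · exact .inl h1
        · exact .inr ⟨f d, rfl, h0.pres d A hd⟩
    · push Not at hinj
      obtain ⟨a, b, A, hab, ha, hb, hne⟩ := hinj
      obtain ⟨D, rfl⟩ := (hf.lin a b A hab ha hb).resolve_left hne
      obtain ⟨B, hB⟩ := Option.ne_none_iff_exists'.1 hb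
      obtain rfl : B = .whyNot D := by
        have h1 := hf.pres a _ ha
        have h2 := hf.pres b _ hB
        grind
      -- After `b` is merged into `a` the same `f` still works, since `f a = f b`.
      have h1 := ih ({c | Ctx.erase Γ b c ≠ none}.ncard) ?_ (h.identify hne ha hB)
        ⟨fun c A hc => hf.pres c A (by grind), fun c c' A h1 h2 h3 =>
          hf.lin c c' A h1 (by grind) (by grind), fun c A hc => ?_⟩ rfl
      · rw [Proc.renC_renC] at h1
        convert h1 using 2
        funext c
        by_cases hc : c = b <;> simp [hc, hab]
      · rw [← hn]
        refine Set.ncard_lt_ncard ⟨fun c hc => ?_, fun hle => ?_⟩ h.finite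
        · simp only [Set.mem_ofPred_eq] at *; grind
        · have := hle hb
          simp at this
      · rcases hf.new c A hc with h2 | ⟨d, rfl, hd⟩
        · exact .inl h2
        · by_cases hdb : d = b
          · exact .inr ⟨a, by grind⟩
          · exact .inr ⟨d, by grind⟩

end Typed

/-! ### From derivations back to typing -/

theorem Ctx.ren_inl {N : Type} {α : Type 1} (Γ : Ctx N α) :
    Ren (fun _ => False) (Sum.inl : N → N ⊕ N) Γ (Sum.elim Γ empty) where
  pres _ _ h := h
  lin _ _ _ h _ _ := .inl (Sum.inl_injective h)
  new
    | .inl c, _, h => .inr ⟨c, rfl, h⟩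

theorem Ctx.ren_inr {N : Type} {α : Type 1} (Γ : Ctx N α) :
    Ren (fun _ => False) (Sum.inr : N → N ⊕ N) Γ (Sum.elim empty Γ) where
  pres _ _ h := h
  lin _ _ _ h _ _ := .inl (Sum.inr_injective h)
  new
    | .inr c, _, h => .inr ⟨c, rfl, h⟩

theorem Ctx.split_sum {N : Type} {α : Type 1} (Γ : Ctx N α) (Γ' : Ctx N α) :
    Split (Sum.elim Γ Γ' : Ctx (N ⊕ N) α) (Sum.elim Γ empty) (Sum.elim empty Γ')
  | .inl _ => .inr ⟨rfl, rfl⟩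
  | .inr _ => .inl ⟨rfl, rfl⟩

/-- A join is a disjoint union followed by contraction: keep the parts in two copies of the scope,
then fold the copies together. Only shared names collide, and their types are in `W`. -/
theorem Ctx.Join.ren_sum {N : Type} {α : Type 1} {W : α → Prop} {Γ Γ₁ Γ₂ : Ctx N α}
    (h : Join W Γ Γ₁ Γ₂) : Ren W (Sum.elim id id) (Sum.elim Γ₁ Γ₂ : Ctx (N ⊕ N) α) Γ where
  pres c A hc := by
    rcases c with c | c
    · exact h.left hc
    · exact h.right hc
  lin c c' A hf hc hc' := by
    have := h (Sum.elim id id c)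
    rcases c with c | c <;> rcases c' with c' | c' <;> simp at * <;> grind
  new c A hc := by
    have := h c
    by_cases h1 : Γ₁ c = none
    · exact .inr ⟨.inr c, rfl, by simp; grind⟩
    · exact .inr ⟨.inl c, rfl, by simp; grind⟩

/-- The implicit structural steps of `Der` are made explicit by `Typed.rename`: at cuts and outputs
by folding two copies of the scope, at requests by merging a fresh channel with the old one, at
leaves by weakening. Finiteness must be assumed, because `Der` also accepts infinite environments.
-/
theorem Proc.Der.typed {C V T : Type} {P : Proc C V T} {Θ : PEnv V T} {Γ : Env C T}
    (h : P.Der Θ Γ) (hfin : Ctx.Finite Γ) : Typed Θ P Γ := by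
  have hw1 : ∀ {C V T : Type} {P : Proc C V T} {Θ : PEnv V T} {Γ : Env C T} {x : C} {A : Ty T},
      Ctx.Finite Γ → Γ x = some A → (∀ c B, c ≠ x → Γ c = some B → B.IsWhyNot) →
      Typed Θ P (Ctx.empty.set x A) → Typed Θ P Γ := by
    intro C V T P Θ Γ x A hfin hx hw h
    refine h.weaken_finite ⟨by simp only [id]; grind, fun _ _ _ h _ _ => .inl h,
      fun c B hc => ?_⟩ hfin
    by_cases hcx : c = x
    · exact .inr ⟨x, by simp only [id]; grind⟩
    · exact .inl (hw c B hcx hc)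
  induction P with
  | send x P Q ihP ihQ =>
    obtain ⟨A, B, Θ₁, Θ₂, Γ₁, Γ₂, hΘ, hx, hj, hP, hQ⟩ := h
    have hfin' := hfin.erase x
    have tP := (ihP hP ((hj.finite_left hfin').ext _)).rename_injective
      ((ren_inl Γ₁).ext A)
    have hxn := hj x
    have tQ := (ihQ hQ ((hj.finite_right hfin').set _ _)).rename_injective
      ((ren_inr Γ₂).insert (x := x) (by grind) B)
    have t := Typed.tensor hΘ (split_sum Γ₁ Γ₂) (by grind) tP tQ
    -- The subject lives in the right copy, since the rule for `⊗` hands `x` on to the right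
    -- premise.
    have hr := hj.ren_sum.insert (x := .inr x) (by simp) (.tensor A B)
    simp only [Sum.elim_inr, id, erase_set hx] at hr
    have := t.rename hr hfin
    simpa [Proc.renC, Proc.rename, Proc.rename_rename, Option.map_comp_map] using this
  | recv x P ih =>
    obtain ⟨A, B, hx, hP⟩ := h
    rw [← erase_set hx]
    exact .par (by simp) (by simpa using ih hP ((hfin.set _ _).ext _))
  | selL x P ih =>
    obtain ⟨A, B, hx, hP⟩ := h
    rw [← erase_set hx]
    exact .plus₁ (by simp) (by simpa using ih hP (hfin.set _ _))
  | selR x P ih =>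
    obtain ⟨A, B, hx, hP⟩ := h
    rw [← erase_set hx]
    exact .plus₂ (by simp) (by simpa using ih hP (hfin.set _ _))
  | offer x P Q ihP ihQ =>
    obtain ⟨A, B, hx, hP, hQ⟩ := h
    rw [← erase_set hx]
    exact .with (by simp) (by simpa using ihP hP (hfin.set _ _))
      (by simpa using ihQ hQ (hfin.set _ _))
  | client x P ih =>
    obtain ⟨A, hx, hP⟩ := h
    have t := (ih hP (hfin.ext _)).rename_injective ((Res.some_wk Γ).toRen.ext A)
    -- The request is made on the fresh name `none`, since `x` may still be in use; `getD x` then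
    -- contracts the two.
    have t := Typed.whyNot (x := none) rfl t
    have hw : (Ty.whyNot A).IsWhyNot := ⟨_, rfl⟩
    have hr : Ren Ty.IsWhyNot (fun c : Option _ => c.getD x) ((wk Γ).set none (.whyNot A)) Γ := by
      refine ⟨fun c B hc => ?_, fun c c' B hf hc hc' => ?_, fun c B hc => ?_⟩
      · cases c <;> simp <;> grind
      · cases c <;> cases c' <;> simp at hf <;> grind
      · exact .inr ⟨some c, rfl, by grind⟩
    have := t.rename hr hfin
    have he : (fun c : Option _ => c.getD x) ∘ some = id := rfl
    simpa [Proc.renC, Proc.rename, Proc.rename_rename, Option.map_comp_map, he] using this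
  | server x P ih =>
    obtain ⟨A, hx, rfl, hw, hP⟩ := h
    rw [← erase_set hx]
    exact .ofCourse (by simp) (fun c B hB => hw c B (by grind) (by grind))
      (ih hP ((hfin.erase _).ext _))
  | sendTy x A P ih =>
    obtain ⟨B, hx, hP⟩ := h
    rw [← erase_set hx]
    exact .ex (by simp) (by simpa using ih hP (hfin.set _ _))
  | recvTy x P ih =>
    obtain ⟨B, hx, hP⟩ := h
    rw [← erase_set hx]
    refine .all (by simp) ?_
    have h1 : Env.shift (Ctx.erase Γ x) = (Γ.map Ty.shift).erase x := map_erase _ _ _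
    rw [h1, erase_set_same]
    exact ih hP ((hfin.map _).set _ _)
  | sendProc x s P ih =>
    obtain ⟨Δ, hx, hw, hP⟩ := h
    exact hw1 hfin hx hw (.provide (ih hP (Set.toFinite _)))
  | recvProc x P ih =>
    obtain ⟨s, Δ, hx, hP⟩ := h
    rw [← erase_set hx]
    exact .assume (by simp) (ih hP (hfin.erase _))
  | run p s ρ =>
    obtain ⟨Δ, rfl, hρ⟩ := h
    -- The record may have become non-injective by contraction, so the axiom is taken at the labels
    -- themselves and then renamed along `ρ`.
    exact (Typed.ident (ρ := id) Function.injective_id (fun _ => rfl) (by simp)).rename hρ hfin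
  | close x =>
    obtain ⟨rfl, hx, hw⟩ := h
    exact hw1 hfin hx hw .one
  | wait x P ih =>
    obtain ⟨hx, hP⟩ := h
    rw [← erase_set hx]
    exact .bot (by simp) (ih hP (hfin.erase _))
  | emptyOffer x =>
    obtain ⟨rfl, hx⟩ := h
    rw [← erase_set hx]
    exact .top (by simp) (hfin.erase _)
  | link x y A =>
    obtain ⟨rfl, hx, hy, hw⟩ := h
    have hxy : x ≠ y := by
      rintro rfl
      exact A.dual_ne (Option.some_injective _ (hx.symm.trans hy))
    refine (Typed.axiomLink hxy).weaken_finite ⟨by simp only [id]; grind,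
      fun _ _ _ h _ _ => .inl h, fun c B hc => ?_⟩ hfin
    have := hw c B
    by_cases h1 : c = x
    · exact .inr ⟨x, by simp only [id]; grind⟩
    by_cases h2 : c = y
    · exact .inr ⟨y, by simp only [id]; grind⟩
    · exact .inl (hw c B h1 h2 hc)
  | cut A P Q ihP ihQ =>
    obtain ⟨Θ₁, Θ₂, Γ₁, Γ₂, hΘ, hj, hP, hQ⟩ := h
    have tP := (ihP hP ((hj.finite_left hfin).ext _)).rename_injective
      ((ren_inl Γ₁).ext A)
    have tQ := (ihQ hQ ((hj.finite_right hfin).ext _)).rename_injective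
      ((ren_inr Γ₂).ext A.dual)
    have := (Typed.cut hΘ (split_sum Γ₁ Γ₂) tP tQ).rename hj.ren_sum hfin
    simpa [Proc.renC, Proc.rename, Proc.rename_rename, Option.map_comp_map] using this
  | chop Q s P ihQ ihP =>
    obtain ⟨Δ, Θ₁, Θ₂, hΘ, hP, hQ⟩ := h
    exact .chop hΘ (ihP hP (Set.toFinite _)) (ihQ hQ hfin)

theorem swap_swap {N : Type} (c : Option (Option N)) : swap (swap c) = c := by
  rcases c with _ | _ | c <;> rfl

/-! ### Distributing bound names over the parts of an environment -/

namespace Ctx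

variable {N N' : Type} {α : Type 1} {W : α → Prop}

@[simp] theorem ext_erase_none (Γ : Ctx N α) (A : α) : (Γ.ext A).erase none = Γ.wk := by
  funext c; cases c <;> grind

@[simp] theorem ext_set_none (Γ : Ctx N α) (A B : α) : (Γ.ext A).set none B = Γ.ext B := by
  funext c; cases c <;> grind

@[simp] theorem wk_set_none (Γ : Ctx N α) (B : α) : Γ.wk.set none B = Γ.ext B := by
  funext c; cases c <;> grind

@[simp] theorem ext_set_some (Γ : Ctx N α) (A : α) (x : N) (B : α) :
    (Γ.ext A).set (some x) B = (Γ.set x B).ext A := by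
  funext c; cases c <;> grind

@[simp] theorem ext_erase_some (Γ : Ctx N α) (A : α) (x : N) :
    (Γ.ext A).erase (some x) = (Γ.erase x).ext A := by
  funext c; cases c <;> grind

theorem Res.insert {f : N → N'} {Γ : Ctx N α} {Γ' : Ctx N' α} (h : Res W f Γ Γ')
    (hf : Function.Injective f) {x : N} (hx : Γ' (f x) = none) (B : α) :
    Res W f (Γ.set x B) (Γ'.set (f x) B) :=
  ⟨h.toRen.insert hx B, fun c => by
    have := h.eq c
    have := hf (a₁ := c) (a₂ := x)
    grind⟩

theorem ren_swap (Γ : Ctx N α) (A B : α) :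
    Ren W swap ((Γ.ext A).ext B) ((Γ.ext B).ext A) where
  pres c D hc := by rcases c with _ | _ | c <;> exact hc
  lin c c' D hf _ _ := .inl (by rw [← swap_swap c, hf, swap_swap])
  new c D hc := .inr ⟨swap c, swap_swap c, by rcases c with _ | _ | c <;> exact hc⟩

theorem res_swap (Γ : Ctx (Option (Option N)) α) : Res W swap (fun c => Γ (swap c)) Γ where
  pres _ _ hc := hc
  lin c c' D hf _ _ := .inl (by rw [← swap_swap c, hf, swap_swap])
  new c D hc := .inr ⟨swap c, swap_swap c, by rwa [swap_swap]⟩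
  eq _ := rfl

theorem Join.ext_left {Γ Γ₁ Γ₂ : Ctx N α} (h : Join W Γ Γ₁ Γ₂) (A : α) :
    Join W (Γ.ext A) (Γ₁.ext A) Γ₂.wk
  | none => .inr (.inl ⟨rfl, rfl⟩)
  | some n => h n

theorem Join.ext_right {Γ Γ₁ Γ₂ : Ctx N α} (h : Join W Γ Γ₁ Γ₂) (A : α) :
    Join W (Γ.ext A) Γ₁.wk (Γ₂.ext A)
  | none => .inl ⟨rfl, rfl⟩
  | some n => h n

theorem Join.insert_left {Γ Γ₁ Γ₂ : Ctx N α} (h : Join W Γ Γ₁ Γ₂) {x : N} (hx : Γ₂ x = none)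
    (B : α) : Join W (Γ.set x B) (Γ₁.set x B) Γ₂ := fun n => by
  have := h n
  grind

theorem Join.erase_left {Γ Γ₁ Γ₂ : Ctx N α} (h : Join W Γ Γ₁ Γ₂) {x : N} (hx : Γ₂ x = none) :
    Join W (Γ.erase x) (Γ₁.erase x) Γ₂ := fun n => by
  have := h n
  grind

/-- The reason why a prefix may leave a cut: its subject is linear, hence absent from the other
side, and may change its type there unnoticed. -/
theorem Join.right_eq_none {Γ Γ₁ Γ₂ : Ctx N α} (h : Join W Γ Γ₁ Γ₂) {x : N} {A : α}
    (hx : Γ₁ x = some A) (hA : ¬ W A) : Γ₂ x = none := by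
  have := h x
  grind

theorem Join.of_wk {Γ : Ctx N α} {Γ₁ Γ₂ : Ctx (Option N) α} (h : Join W Γ.wk Γ₁ Γ₂) :
    ∃ Γ₁' Γ₂' : Ctx N α, Γ₁ = Γ₁'.wk ∧ Γ₂ = Γ₂'.wk ∧ Join W Γ Γ₁' Γ₂' := by
  have hn := h none
  refine ⟨fun n => Γ₁ (some n), fun n => Γ₂ (some n), funext fun c => ?_, funext fun c => ?_,
    fun n => h (some n)⟩ <;> cases c <;> grind

/-- The innermost name can be allotted to the right part alone. If the left part declares it too,
its type is in `W` and it can be strengthened away there; if the right part lacks it, then `A` is in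
`W` and it can be weakened in. -/
theorem Join.of_ext_right {Γ : Ctx N α} {Γ₁ Γ₂ : Ctx (Option N) α} {A : α}
    (h : Join W (Γ.ext A) Γ₁ Γ₂) (hA : Γ₂ none ≠ none ∨ W A) :
    ∃ Γ₁' Γ₂' : Ctx N α, Join W Γ Γ₁' Γ₂' ∧ Res W some Γ₁' Γ₁ ∧ Ren W id Γ₂ (Γ₂'.ext A) := by
  have hn := h none
  refine ⟨fun n => Γ₁ (some n), fun n => Γ₂ (some n), fun n => h (some n),
    ⟨⟨fun _ _ h => h, fun _ _ _ h _ _ => .inl (Option.some_injective _ h), fun c B hc => ?_⟩,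
      fun _ => rfl⟩, fun c B hc => ?_, fun _ _ _ h _ _ => .inl h, fun c B hc => ?_⟩
  · cases c with
    | none => exact .inl (by grind)
    | some c => exact .inr ⟨c, rfl, hc⟩
  · cases c with
    | none => simp; grind
    | some c => exact hc
  · cases c with
    | none =>
      by_cases hW : W A
      · exact .inl (by grind)
      · exact .inr ⟨none, rfl, by grind⟩
    | some c => exact .inr ⟨some c, rfl, hc⟩

theorem Join.of_ext_left {Γ : Ctx N α} {Γ₁ Γ₂ : Ctx (Option N) α} {A : α}
    (h : Join W (Γ.ext A) Γ₁ Γ₂) (hA : Γ₁ none ≠ none ∨ W A) :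
    ∃ Γ₁' Γ₂' : Ctx N α, Join W Γ Γ₁' Γ₂' ∧ Res W some Γ₂' Γ₂ ∧ Ren W id Γ₁ (Γ₁'.ext A) := by
  obtain ⟨Γ₂', Γ₁', h1, h2, h3⟩ := h.symm.of_ext_right hA
  exact ⟨Γ₁', Γ₂', h1.symm, h2, h3⟩

theorem Split.of_ext_right {Γ : Ctx N α} {Γ₁ Γ₂ : Ctx (Option N) α} {A : α}
    (h : (Γ.ext A).Split Γ₁ Γ₂) (hA : Γ₂ none ≠ none) :
    ∃ Γ₁' Γ₂' : Ctx N α, Γ.Split Γ₁' Γ₂' ∧ Res (fun _ => False) some Γ₁' Γ₁ ∧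
      Γ₂ = Γ₂'.ext A := by
  have hn := h none
  obtain ⟨Γ₁', Γ₂', h1, h2, h3⟩ := ((split_iff_join _ _ _).1 h).of_ext_right (.inl hA)
  refine ⟨Γ₁', Γ₂', (split_iff_join _ _ _).2 h1, h2, funext fun c => ?_⟩
  rcases hc : Γ₂ c with _ | B
  · by_contra hne
    obtain ⟨D, hD⟩ := Option.ne_none_iff_exists'.1 (Ne.symm hne)
    obtain ⟨d, hd, hd'⟩ := (h3.new c D hD).resolve_left id
    obtain rfl : d = c := hd
    simp [hc] at hd'
  · exact (h3.pres c B hc).symm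

theorem Split.of_ext_left {Γ : Ctx N α} {Γ₁ Γ₂ : Ctx (Option N) α} {A : α}
    (h : (Γ.ext A).Split Γ₁ Γ₂) (hA : Γ₁ none ≠ none) :
    ∃ Γ₁' Γ₂' : Ctx N α, Γ.Split Γ₁' Γ₂' ∧ Res (fun _ => False) some Γ₂' Γ₂ ∧
      Γ₁ = Γ₁'.ext A := by
  obtain ⟨Γ₂', Γ₁', h1, h2, h3⟩ := h.symm.of_ext_right hA
  exact ⟨Γ₁', Γ₂', h1.symm, h2, h3⟩

/-- Exchange of the last two parts of an environment. -/
theorem Join.exchange {Γ Γ₁ Γ₂ Γ₃ Γ₄ : Ctx N α} (h : Join W Γ Γ₁ Γ₂) (h' : Join W Γ₁ Γ₃ Γ₄) :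
    ∃ Δ, Join W Γ Δ Γ₄ ∧ Join W Δ Γ₃ Γ₂ := by
  obtain ⟨Δ, h1, h2⟩ := h.assoc h'.symm
  exact ⟨Δ, h1.symm, h2⟩

theorem Split.exchange {Γ Γ₁ Γ₂ Γ₃ Γ₄ : Ctx N α} (h : Γ.Split Γ₁ Γ₂) (h' : Γ₁.Split Γ₃ Γ₄) :
    ∃ Δ, Γ.Split Δ Γ₄ ∧ Δ.Split Γ₃ Γ₂ := by
  obtain ⟨Δ, h1, h2⟩ := h.assoc h'.symm
  exact ⟨Δ, h1.symm, h2⟩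

theorem Join.ren_left {Γ Γ₁ Γ₂ : Ctx N α} (h : Join W Γ Γ₁ Γ₂)
    (hW : ∀ c A, Γ₂ c = some A → W A) : Ren W id Γ₁ Γ where
  pres _ _ hc := h.left hc
  lin _ _ _ hf _ _ := .inl hf
  new c A hc := by
    have := h c
    have := hW c A
    by_cases hA : W A
    · exact .inl hA
    · exact .inr ⟨c, rfl, by grind⟩

theorem Join.ren_right {Γ Γ₁ Γ₂ : Ctx N α} (h : Join W Γ Γ₁ Γ₂)
    (hW : ∀ c A, Γ₁ c = some A → W A) : Ren W id Γ₂ Γ := h.symm.ren_left hW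

/-- An environment with only `?`-types can be shared once more; this pays for the copy of a server.
-/
theorem Join.self_left {Γ Γ₁ Γ₂ : Ctx N α} (h : Join W Γ Γ₁ Γ₂)
    (hW : ∀ c A, Γ₂ c = some A → W A) : Join W Γ Γ Γ₂ := fun c => by
  have h1 := h c
  rcases hc : Γ₂ c with _ | A
  · simp
  · exact .inr (.inr ⟨A, hW c A hc, h.right hc, h.right hc, rfl⟩)

end Ctx

/-! ### Preservation by structural equivalence and by reduction -/

namespace Proc

theorem Der.cut_comm {C V T : Type} {A : Ty T} {P Q : Proc (Option C) V T} {Θ : PEnv V T}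
    {Γ : Env C T} (h : (cut A P Q).Der Θ Γ) : (cut A.dual Q P).Der Θ Γ := by
  obtain ⟨Θ₁, Θ₂, Γ₁, Γ₂, hΘ, hj, hP, hQ⟩ := h
  exact ⟨_, _, _, _, hΘ.symm, hj.symm, hQ, by rwa [Ty.dual_dual]⟩

/-- The side condition puts `z` in the environment of `Q`, or allows weakening it in; `P` does not
use `z`, so it is strengthened. It is phrased through derivations of `Q` so that it also applies to
`Q` with its two bound names exchanged. -/
theorem Der.cut_assoc {C V T : Type} {A B : Ty T} {P : Proc (Option C) V T}
    {Q : Proc (Option (Option C)) V T} {R : Proc (Option C) V T} {Θ : PEnv V T} {Γ : Env C T}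
    (hz : (∀ Θ Γ, Q.Der Θ Γ → Γ (some none) ≠ none) ∨ A.IsWhyNot)
    (h : (cut A (cut B (P.renC (Option.map some)) Q) R).Der Θ Γ) :
    (cut B P (cut A (Q.renC swap) (R.renC (Option.map some)))).Der Θ Γ := by
  obtain ⟨Θ₁, Θ₂, Γ₁, Γ₂, hΘ, hj, ⟨Θ₃, Θ₄, Γ₃, Γ₄, hΘ', hj', hP, hQ⟩, hR⟩ := h
  obtain ⟨Γ₃', Γ₄', h1, h2, h3⟩ := hj'.of_ext_right (hz.imp_left fun h => h _ _ hQ)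
  obtain ⟨Δ, h4, h5⟩ := hj.assoc h1
  obtain ⟨Ξ, h6, h7⟩ := hΘ.assoc hΘ'
  have hQ' := hQ.weaken (by simpa using h3.ext B.dual)
  exact ⟨_, _, _, _, h6, h4, hP.of_renC (h2.ext B), _, _, _, _, h7, h5.ext_left _,
    hQ'.renC (ren_swap _ _ _), hR.renC ((Res.some_wk _).toRen.ext _)⟩

end Proc

/-- An equivalence is needed for the symmetry rule to go through by induction. -/
theorem SEquiv.der_iff {C V T : Type} {P Q : Proc C V T} (h : SEquiv P Q) (Θ : PEnv V T)
    (Γ : Env C T) : P.Der Θ Γ ↔ Q.Der Θ Γ := by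
  induction h with
  | linkSymm x y A =>
    simp only [Proc.Der, Ty.dual_dual]
    grind
  | cutComm A P Q =>
    refine ⟨Proc.Der.cut_comm, fun h => ?_⟩
    simpa using h.cut_comm
  | cutAssoc A B P Q R hz hy =>
    refine ⟨Proc.Der.cut_assoc (hz.imp_left fun h Θ Γ hQ => hQ.ne_none_of_mem_fc h), ?_⟩
    rintro ⟨Θ₁, Θ₂, Γ₁, Γ₂, hΘ, hj, hP, hQ⟩
    -- The converse is the same implication read in a mirror: commuting both cuts exchanges the
    -- roles of `z` and `y`, and of `A` and the dual of `B`.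
    have h1 : (Proc.cut B.dual (.cut A.dual (R.renC (Option.map some)) (Q.renC swap)) P).Der Θ Γ :=
      ⟨_, _, _, _, hΘ.symm, hj.symm, hQ.cut_comm, by rwa [Ty.dual_dual]⟩
    obtain ⟨Θ₁, Θ₂, Γ₁, Γ₂, hΘ, hj, hP, hQ⟩ := (h1.cut_assoc (hy.imp_left fun h Θ Γ hQ =>
      (hQ.of_renC (res_swap Γ)).ne_none_of_mem_fc (c := none) h)).cut_comm
    have h2 := hP.cut_comm
    rw [Proc.renC_renC, Proc.renC_of_eq_id (f := swap ∘ swap) swap_swap] at h2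
    simp only [Ty.dual_dual] at h2 hQ ⊢
    exact ⟨_, _, _, _, hΘ, hj, h2, hQ⟩
  | refl P => rfl
  | symm _ ih => exact (ih Θ Γ).symm
  | trans _ _ ih₁ ih₂ => exact (ih₁ Θ Γ).trans (ih₂ Θ Γ)
  -- Congruence: `Der` depends on subprocesses only through their own derivations.
  | _ => simp only [Proc.Der, *]

theorem Principal.der {C V T : Type} {P Q : Proc C V T} (h : Principal P Q) {Θ : PEnv V T}
    {Γ : Env C T} (hP : P.Der Θ Γ) : Q.Der Θ Γ := by
  cases h with
  | tensorPar A B P Q R =>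
    obtain ⟨Θ₁, Θ₂, Γ₁, Γ₂, hΘ, hj, ⟨A', B', Θ₃, Θ₄, Γ₃, Γ₄, hΘ', hx, hj', hP, hQ⟩,
      A'', B'', hy, hR⟩ := hP
    cases hx
    cases hy
    rw [ext_erase_none] at hj'
    obtain ⟨Γ₃', Γ₄', rfl, rfl, h1⟩ := hj'.of_wk
    obtain ⟨Δ, h2, h3⟩ := hj.assoc h1
    obtain ⟨Ξ, h4, h5⟩ := hΘ.assoc hΘ'
    simp only [ext_set_none, wk_set_none] at hR hQ
    exact ⟨_, _, _, _, h4, h2, hP.of_renC ((Res.some_wk _).ext _), _, _, _, _, h5,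
      h3.ext_right _, hQ.renC ((Res.some_wk _).toRen.ext _), hR.renC (ren_swap _ _ _)⟩
  | selectL A B P Q R =>
    obtain ⟨Θ₁, Θ₂, Γ₁, Γ₂, hΘ, hj, ⟨A', B', hx, hP⟩, A'', B'', hy, hQ, hR⟩ := hP
    cases hx
    cases hy
    simp only [ext_set_none] at hP hQ
    exact ⟨_, _, _, _, hΘ, hj, hP, hQ⟩
  | selectR A B P Q R =>
    obtain ⟨Θ₁, Θ₂, Γ₁, Γ₂, hΘ, hj, ⟨A', B', hx, hP⟩, A'', B'', hy, hQ, hR⟩ := hP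
    cases hx
    cases hy
    simp only [ext_set_none] at hP hR
    exact ⟨_, _, _, _, hΘ, hj, hP, hR⟩
  | serve A P Q =>
    obtain ⟨Θ₁, Θ₂, Γ₁, Γ₂, hΘ, hj, ⟨A', hx, hQ⟩, A'', hy, rfl, hw, hP⟩ := hP
    cases hx
    cases hy
    simp only [ext_erase_none] at hP
    exact ⟨_, _, _, _, hΘ, hj, hQ.of_renC ((Res.some_ext _ ⟨_, rfl⟩).ext _),
      hP.of_renC ((Res.some_wk _).ext _)⟩
  | discard A P Q =>
    obtain ⟨Θ₁, Θ₂, Γ₁, Γ₂, hΘ, hj, hP, A'', hy, rfl, hw, hQ⟩ := hP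
    obtain rfl := split_empty_left hΘ.symm
    -- The discarded server had only `?`-channels, so what it declared is restored by weakening.
    exact (hP.of_renC (Res.some_ext _ ⟨_, rfl⟩)).weaken
      (hj.ren_left fun c B hc => hw (some c) B (by simp) hc)
  | replicate A P Q =>
    obtain ⟨Θ₁, Θ₂, Γ₁, Γ₂, hΘ, hj, hP, A'', hy, rfl, hw, hQ⟩ := hP
    cases hy
    have hw' : ∀ c B, Γ₂ c = some B → B.IsWhyNot := fun c B hc => hw (some c) B (by simp) hc
    have hA : (Ty.whyNot A).IsWhyNot := ⟨_, rfl⟩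
    simp only [ext_erase_none] at hQ
    have hP' : P.Der Θ₁ ((Γ₁.ext (.whyNot A)).ext (.whyNot A)) := by
      -- Reflection along `Option.join` undoes the contraction: each of the two merged names gets
      -- the type `?A`.
      refine hP.of_renC ⟨⟨fun c B hc => ?_, fun c c' B hf hc hc' => ?_, fun c B hc =>
        .inr ⟨some c, rfl, hc⟩⟩, fun c => ?_⟩
      · rcases c with _ | _ | c <;> exact hc
      · rcases c with _ | _ | c <;> rcases c' with _ | _ | c' <;> simp at hf hc hc' ⊢ <;> grind
      · rcases c with _ | _ | c <;> rfl
    have hQ' := hQ.of_renC ((Res.some_wk _).ext _)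
    have hs : (Proc.server none (Q.renC (Option.map fun c => some (some c)))).Der
        Ctx.empty (Γ₂.wk.ext (Ty.whyNot A).dual) := by
      refine ⟨A.dual, rfl, rfl, fun c B hc hB => ?_, ?_⟩
      · rcases c with _ | _ | c
        · exact (hc rfl).elim
        · cases hB
        · exact hw' c B hB
      · rw [ext_erase_none]
        exact hQ'.renC (((Res.some_wk _).toRen.comp (Res.some_wk _).toRen).ext _)
    -- The outer cut gives all of `Γ` to the inner one and shares `Γ₂` with the second server. Both
    -- servers use no process variables, so those stay with `P`.
    refine ⟨_, _, Γ, Γ₂, hΘ, hj.self_left hw', ⟨_, _, _, _, split_empty _, hj.ext_left _, hP', hs⟩,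
      A.dual, rfl, rfl, hw, ?_⟩
    rw [ext_erase_none]
    exact hQ
  | poly A B P Q =>
    obtain ⟨Θ₁, Θ₂, Γ₁, Γ₂, hΘ, hj, ⟨B', hx, hP⟩, B'', hy, hQ⟩ := hP
    cases hx
    cases hy
    rw [ext_set_none] at hP
    -- Everything but the type of the bound channel is shifted, so the substitution leaves it as it
    -- was before the quantifier.
    have h := hQ.tsubst (σ := Ty.single A)
    rw [map_ext, ext_set_none, map_ext, map_map, map_map,
      map_id' (fun D => by simp [PTy.subst, PTy.shift]),
      map_id' (fun D => Ty.shift_subst_single A D), Ty.subst_dual] at h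
    exact ⟨_, _, _, _, hΘ, hj, hP, h⟩
  | unit P =>
    obtain ⟨Θ₁, Θ₂, Γ₁, Γ₂, hΘ, hj, ⟨rfl, hx, hw⟩, hy, hP⟩ := hP
    obtain rfl := split_empty_left hΘ
    rw [ext_erase_none] at hP
    exact (hP.of_renC (Res.some_wk _)).weaken
      (hj.ren_right fun c B hc => hw (some c) B (by simp) hc)
  | higherOrder s' Δ s P Q =>
    obtain ⟨Θ₁, Θ₂, Γ₁, Γ₂, hΘ, hj, ⟨Δ', hx, hw, hP⟩, s'', Δ'', hy, hQ⟩ := hP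
    cases hx
    cases hy
    rw [ext_erase_none] at hQ
    exact ⟨_, _, _, hΘ, hP, (hQ.of_renC (Res.some_wk _)).weaken
      (hj.ren_right fun c B hc => hw (some c) B (by simp) hc)⟩
  | run s ρ P =>
    obtain ⟨Δ, Θ₁, Θ₂, hΘ, hP, Δ', he, hρ⟩ := hP
    -- `Θ₂` extended by `p` equals a singleton at `p`, so the process types agree and `Θ₂` is empty.
    have h1 := congrFun he none
    simp only [ext_none, set_same, Option.some.injEq, PTy.mk.injEq, heq_eq_eq, true_and] at h1
    subst h1
    obtain rfl : Θ₂ = Ctx.empty := funext fun v => by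
      have := congrFun he (some v)
      grind
    obtain rfl := split_empty_left hΘ.symm
    exact hP.renC hρ
  | link X w P =>
    obtain ⟨Θ₁, Θ₂, Γ₁, Γ₂, hΘ, hj, ⟨rfl, hx, -, hw⟩, hP⟩ := hP
    obtain rfl := split_empty_left hΘ
    have hl : ¬ (Ty.dvar X).IsWhyNot := by simp [Ty.IsWhyNot]
    have hx : Γ₁ w = some (.dvar X) := hx
    -- The type of `w` is atomic, hence linear: `P` does not have `w`, and renaming its bound
    -- channel to `w` causes no clash.
    have h2 := hj.right_eq_none hx hl
    have hw' : ∀ c B, c ≠ w → Γ₁ c = some B → B.IsWhyNot := fun c B hc =>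
      hw (some c) B (by simpa using hc) (by simp)
    refine hP.renC ⟨fun c B hc => ?_, fun c c' B hf hc hc' => ?_, fun c B hc => ?_⟩
    · cases c with
      | none => cases hc; exact hj.left hx
      | some c => exact hj.right hc
    · cases c <;> cases c' <;> simp at hf hc hc' ⊢ <;> grind
    · by_cases hcw : c = w
      · refine .inr ⟨none, hcw.symm, ?_⟩
        rw [← hc, hcw, hj.left hx]
        rfl
      · have h3 := hw' c B hcw
        have h4 := hj c
        by_cases hW : B.IsWhyNot
        · exact .inl hW
        · exact .inr ⟨some c, rfl, by rw [ext_some]; grind⟩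

theorem Eta.der {C V T : Type} {P Q : Proc C V T} (h : Eta P Q) {Θ : PEnv V T}
    {Γ : Env C T} (hP : P.Der Θ Γ) : Q.Der Θ Γ := by
  cases h with
  | tensor x y A B =>
    obtain ⟨rfl, hx, hy, hw⟩ := hP
    have hxy : y ≠ x := by rintro rfl; simp [hx, Ty.dual] at hy
    -- The first link gets just the received channel; the second gets all the rest and absorbs the
    -- surplus `?`-declarations.
    refine ⟨A.dual, B.dual, hx, A, B, Ctx.empty, Ctx.empty, (Ctx.empty : Env C T).ext A.dual,
      ((Ctx.erase Γ y).set x B.dual).wk, split_empty _, by grind, fun c => ?_,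
      ⟨rfl, rfl, rfl, fun c D h1 h2 hc => ?_⟩, rfl, by grind, by grind, fun c D h1 h2 hc => ?_⟩
    · rcases c with _ | c <;> grind
    · rcases c with _ | _ | c <;> simp_all
    · rcases c with _ | c
      · simp [set_apply] at hc
      · exact hw c D (by grind) (by grind) (by grind)
  | one x y =>
    obtain ⟨rfl, hx, hy, hw⟩ := hP
    have hxy : y ≠ x := by rintro rfl; simp [hx, Ty.dual] at hy
    exact ⟨hx, rfl, by grind, by grind⟩
  | plus x y A B =>
    obtain ⟨rfl, hx, hy, hw⟩ := hP
    have hxy : y ≠ x := by rintro rfl; simp [hx, Ty.dual] at hy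
    exact ⟨A.dual, B.dual, hx, ⟨A, B, by grind, rfl, by grind, by grind, by grind⟩,
      A, B, by grind, rfl, by grind, by grind, by grind⟩
  | zero x y =>
    obtain ⟨rfl, hx, hy, hw⟩ := hP
    exact ⟨rfl, hx⟩
  | whyNot x y A =>
    obtain ⟨rfl, hx, hy, hw⟩ := hP
    have hxy : y ≠ x := by rintro rfl; simp [hx, Ty.dual] at hy
    have hA : (Ty.whyNot A).IsWhyNot := ⟨_, rfl⟩
    refine ⟨A.dual, hx, rfl, by grind, A, by grind, rfl, rfl, rfl, fun c D h1 h2 hc => ?_⟩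
    rcases c with _ | _ | c <;> grind
  | ex x y A =>
    obtain ⟨rfl, hx, hy, hw⟩ := hP
    have hxy : y ≠ x := by rintro rfl; simp [hx, Ty.dual] at hy
    refine ⟨A.dual, hx, A.rename (Option.map some), ?_, ?_⟩
    · simp [set_apply, hxy, map, hy, Ty.shift, Ty.rename]
    · rw [Ty.rename_some_subst_single]
      refine ⟨rfl, by grind, by grind, fun c D h1 h2 hc => ?_⟩
      simp only [set_apply, h1, h2, if_false, map, Option.map_eq_some_iff] at hc
      obtain ⟨E, hE, rfl⟩ := hc
      exact (hw c E h1 h2 hE).shift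
  | provide x y s Δ =>
    obtain ⟨rfl, hx, hy, hw⟩ := hP
    have hxy : y ≠ x := by rintro rfl; simp [hx, Ty.dual] at hy
    refine ⟨s, Δ, hx, Δ, by grind, by grind, Δ, funext fun v => ?_, Ren.refl _⟩
    cases v <;> grind

/-- Finiteness enters only through the server conversion, whose side condition quantifies over
typings and not over `Der`. -/
theorem Commute.der {C V T : Type} {P Q : Proc C V T} (h : Commute P Q) {Θ : PEnv V T}
    {Γ : Env C T} (hΓ : Ctx.Finite Γ) (hP : P.Der Θ Γ) : Q.Der Θ Γ := by
  cases h with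
  | cutSend₁ A x P Q R hz =>
    obtain ⟨Θ₁, Θ₂, Γ₁, Γ₂, hΘ, hj, ⟨A', B', Θ₃, Θ₄, Γ₃, Γ₄, hΘ', hx, hj', hP, hQ⟩, hR⟩ := hP
    have h0 := hj.right_eq_none hx (by simp [Ty.IsWhyNot])
    have hx4 := hj' (some x)
    rw [ext_erase_some] at hj'
    -- As `z` is free in `P`, it belongs to the left part, where the cut has to go.
    obtain ⟨Γ₃', Γ₄', h1, h2, h3⟩ := hj'.of_ext_left (.inl (hP.ne_none_of_mem_fc hz))
    obtain ⟨Δ, h4, h5⟩ := (hj.erase_left h0).exchange h1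
    obtain ⟨Ξ, h6, h7⟩ := hΘ.exchange hΘ'
    have hQ' := hQ.of_renC (h2.insert (Option.some_injective _) (by grind) _)
    have hP' := hP.weaken (by simpa using h3.ext A')
    exact ⟨A', B', _, _, _, _, h6, hj.left hx, h4, ⟨_, _, _, _, h7, h5.ext_left _,
      hP'.renC (ren_swap _ _ _), hR.renC ((Res.some_wk _).toRen.ext _)⟩, hQ'⟩
  | cutSend₂ A x P Q R hz =>
    obtain ⟨Θ₁, Θ₂, Γ₁, Γ₂, hΘ, hj, ⟨A', B', Θ₃, Θ₄, Γ₃, Γ₄, hΘ', hx, hj', hP, hQ⟩, hR⟩ := hP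
    have h0 := hj.right_eq_none hx (by simp [Ty.IsWhyNot])
    have hx4 := hj' (some x)
    have hz4 := hQ.ne_none_of_mem_fc hz
    rw [ext_erase_some] at hj'
    obtain ⟨Γ₃', Γ₄', h1, h2, h3⟩ := hj'.of_ext_right (.inl (by grind))
    obtain ⟨Δ, h4, h5⟩ := (hj.erase_left h0).assoc h1
    obtain ⟨Ξ, h6, h7⟩ := hΘ.assoc hΘ'
    have hx4' := h1 x
    have hQ' := hQ.weaken (h3.insert (x := some x) (by simp; grind) B')
    simp only [id, ext_set_some] at hQ'
    exact ⟨A', B', _, _, _, _, h6, hj.left hx, h4, hP.of_renC (h2.ext _), _, _, _, _, h7,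
      h5.insert_left h0 _, hQ', hR⟩
  | cutRecv A x P Q =>
    obtain ⟨Θ₁, Θ₂, Γ₁, Γ₂, hΘ, hj, ⟨A', B', hx, hP⟩, hQ⟩ := hP
    have h0 := hj.right_eq_none hx (by simp [Ty.IsWhyNot])
    rw [ext_set_some] at hP
    exact ⟨A', B', hj.left hx, _, _, _, _, hΘ, (hj.insert_left h0 _).ext_left _,
      hP.renC (ren_swap _ _ _), hQ.renC ((Res.some_wk _).toRen.ext _)⟩
  | cutSelL A x P Q =>
    obtain ⟨Θ₁, Θ₂, Γ₁, Γ₂, hΘ, hj, ⟨A', B', hx, hP⟩, hQ⟩ := hP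
    have h0 := hj.right_eq_none hx (by simp [Ty.IsWhyNot])
    rw [ext_set_some] at hP
    exact ⟨A', B', hj.left hx, _, _, _, _, hΘ, hj.insert_left h0 _, hP, hQ⟩
  | cutSelR A x P Q =>
    obtain ⟨Θ₁, Θ₂, Γ₁, Γ₂, hΘ, hj, ⟨A', B', hx, hP⟩, hQ⟩ := hP
    have h0 := hj.right_eq_none hx (by simp [Ty.IsWhyNot])
    rw [ext_set_some] at hP
    exact ⟨A', B', hj.left hx, _, _, _, _, hΘ, hj.insert_left h0 _, hP, hQ⟩
  | cutOffer A x P Q R =>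
    obtain ⟨Θ₁, Θ₂, Γ₁, Γ₂, hΘ, hj, ⟨A', B', hx, hP, hQ⟩, hR⟩ := hP
    have h0 := hj.right_eq_none hx (by simp [Ty.IsWhyNot])
    rw [ext_set_some] at hP hQ
    exact ⟨A', B', hj.left hx, ⟨_, _, _, _, hΘ, hj.insert_left h0 _, hP, hR⟩,
      _, _, _, _, hΘ, hj.insert_left h0 _, hQ, hR⟩
  | cutServer A x P Q hQ' =>
    obtain ⟨Θ₁, Θ₂, Γ₁, Γ₂, hΘ, hj, ⟨A', hx, rfl, hw, hP⟩, hQ⟩ := hP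
    have h0 := hj.right_eq_none hx (by simp [Ty.IsWhyNot])
    obtain ⟨rfl, hw'⟩ := hQ' _ _ (hQ.typed ((hj.finite_right hΓ).ext _))
    obtain rfl := split_empty_left hΘ
    rw [ext_erase_some] at hP
    refine ⟨A', hj.left hx, rfl, fun c B hc hB => ?_, _, _, _, _, hΘ,
      (hj.erase_left h0).ext_left _, hP.renC (ren_swap _ _ _),
      hQ.renC ((Res.some_wk _).toRen.ext _)⟩
    have h1 := hj c
    have h2 := hw (some c) B (by simpa using hc)
    have h3 := hw' c B
    grind
  | cutClient A x P Q =>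
    obtain ⟨Θ₁, Θ₂, Γ₁, Γ₂, hΘ, hj, ⟨A', hx, hP⟩, hQ⟩ := hP
    -- The subject has a `?`-type and may be shared with `Q`; no disjointness is needed, as its
    -- declaration does not change.
    exact ⟨A', hj.left hx, _, _, _, _, hΘ, hj.ext_left _, hP.renC (ren_swap _ _ _),
      hQ.renC ((Res.some_wk _).toRen.ext _)⟩
  | cutSendTy A x B P Q =>
    obtain ⟨Θ₁, Θ₂, Γ₁, Γ₂, hΘ, hj, ⟨B', hx, hP⟩, hQ⟩ := hP
    have h0 := hj.right_eq_none hx (by simp [Ty.IsWhyNot])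
    rw [ext_set_some] at hP
    exact ⟨B', hj.left hx, _, _, _, _, hΘ, hj.insert_left h0 _, hP, hQ⟩
  | cutRecvTy A x P Q =>
    obtain ⟨Θ₁, Θ₂, Γ₁, Γ₂, hΘ, hj, ⟨B', hx, hP⟩, hQ⟩ := hP
    have h0 := hj.right_eq_none hx (by simp [Ty.IsWhyNot])
    rw [map_ext, ext_set_some] at hP
    have hQ' := hQ.tshift
    rw [map_ext, Ty.shift_dual] at hQ'
    exact ⟨B', hj.left hx, _, _, _, _, hΘ.map,
      (hj.map (φ := Ty.shift) fun _ => Ty.IsWhyNot.shift).insert_left (by simp [map, h0]) _,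
      hP, hQ'⟩
  | cutWait A x P Q =>
    obtain ⟨Θ₁, Θ₂, Γ₁, Γ₂, hΘ, hj, ⟨hx, hP⟩, hQ⟩ := hP
    have h0 := hj.right_eq_none hx (by simp [Ty.IsWhyNot])
    rw [ext_erase_some] at hP
    exact ⟨hj.left hx, _, _, _, _, hΘ, hj.erase_left h0, hP, hQ⟩
  | cutEmptyOffer A x Q hfv =>
    obtain ⟨Θ₁, Θ₂, Γ₁, Γ₂, hΘ, hj, ⟨rfl, hx⟩, hQ⟩ := hP
    obtain rfl := split_empty_left hΘ
    -- The channels of the dropped `Q` are absorbed by `⊤`; its process environment is empty because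
    -- `Q` has no free process variable.
    refine ⟨funext fun v => ?_, hj.left hx⟩
    have := hQ.mem_fv_iff v
    simpa [hfv] using this
  | chopCut₁ A P Q s R hr =>
    obtain ⟨Δ, Θ₁, Θ₂, hΘ, hR, Θ₃, Θ₄, Γ₁, Γ₂, hΘ', hj, hP, hQ⟩ := hP
    -- By linearity the variable is declared only on the side where it is free, so the substitution
    -- may move there.
    obtain ⟨Θ₃', Θ₄', h1, h2, rfl⟩ := hΘ'.of_ext_left ((hP.mem_fv_iff _).1 hr)
    obtain ⟨Ξ, h3, h4⟩ := hΘ.symm.exchange h1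
    exact ⟨_, _, _, _, h3, hj, ⟨_, _, _, h4.symm, hR, hP⟩, hQ.of_renV h2⟩
  | chopCut₂ A P Q s R hr =>
    obtain ⟨Δ, Θ₁, Θ₂, hΘ, hR, Θ₃, Θ₄, Γ₁, Γ₂, hΘ', hj, hP, hQ⟩ := hP
    obtain ⟨Θ₃', Θ₄', h1, h2, rfl⟩ := hΘ'.of_ext_right ((hQ.mem_fv_iff _).1 hr)
    obtain ⟨Ξ, h3, h4⟩ := hΘ.symm.assoc h1
    exact ⟨_, _, _, _, h3, hj, hP.of_renV h2, _, _, _, h4.symm, hR, hQ⟩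
  | chopSend₁ x P Q s R hr =>
    obtain ⟨Δ, Θ₁, Θ₂, hΘ, hR, A, B, Θ₃, Θ₄, Γ₁, Γ₂, hΘ', hx, hj, hP, hQ⟩ := hP
    obtain ⟨Θ₃', Θ₄', h1, h2, rfl⟩ := hΘ'.of_ext_left ((hP.mem_fv_iff _).1 hr)
    obtain ⟨Ξ, h3, h4⟩ := hΘ.symm.exchange h1
    exact ⟨A, B, _, _, _, _, h3, hx, hj, ⟨_, _, _, h4.symm, hR, hP⟩, hQ.of_renV h2⟩
  | chopSend₂ x P Q s R hr =>
    obtain ⟨Δ, Θ₁, Θ₂, hΘ, hR, A, B, Θ₃, Θ₄, Γ₁, Γ₂, hΘ', hx, hj, hP, hQ⟩ := hP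
    obtain ⟨Θ₃', Θ₄', h1, h2, rfl⟩ := hΘ'.of_ext_right ((hQ.mem_fv_iff _).1 hr)
    obtain ⟨Ξ, h3, h4⟩ := hΘ.symm.assoc h1
    exact ⟨A, B, _, _, _, _, h3, hx, hj, hP.of_renV h2, _, _, _, h4.symm, hR, hQ⟩
  | chopRecv x P s R =>
    obtain ⟨Δ, Θ₁, Θ₂, hΘ, hR, A, B, hx, hP⟩ := hP
    exact ⟨A, B, hx, Δ, _, _, hΘ, hR, hP⟩
  | chopSelL x P s R =>
    obtain ⟨Δ, Θ₁, Θ₂, hΘ, hR, A, B, hx, hP⟩ := hP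
    exact ⟨A, B, hx, Δ, _, _, hΘ, hR, hP⟩
  | chopSelR x P s R =>
    obtain ⟨Δ, Θ₁, Θ₂, hΘ, hR, A, B, hx, hP⟩ := hP
    exact ⟨A, B, hx, Δ, _, _, hΘ, hR, hP⟩
  | chopOffer x P Q s R =>
    obtain ⟨Δ, Θ₁, Θ₂, hΘ, hR, A, B, hx, hP, hQ⟩ := hP
    exact ⟨A, B, hx, ⟨Δ, _, _, hΘ, hR, hP⟩, Δ, _, _, hΘ, hR, hQ⟩
  | chopClient x P s R =>
    obtain ⟨Δ, Θ₁, Θ₂, hΘ, hR, A, hx, hP⟩ := hP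
    exact ⟨A, hx, Δ, _, _, hΘ, hR, hP⟩
  | chopSendTy x A P s R =>
    obtain ⟨Δ, Θ₁, Θ₂, hΘ, hR, B, hx, hP⟩ := hP
    exact ⟨B, hx, Δ, _, _, hΘ, hR, hP⟩
  | chopRecvTy x P s R =>
    obtain ⟨Δ, Θ₁, Θ₂, hΘ, hR, B, hx, hP⟩ := hP
    rw [map_ext] at hP
    exact ⟨B, hx, _, _, _, hΘ.map, hR.tshift, hP⟩
  | chopSendProc x s' P s R =>
    obtain ⟨Δ, Θ₁, Θ₂, hΘ, hR, Δ', hx, hw, hP⟩ := hP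
    exact ⟨Δ', hx, hw, Δ, _, _, hΘ, hR, hP⟩
  | chopRecvProc x P s R =>
    obtain ⟨Δ, Θ₁, Θ₂, hΘ, hR, s', Δ', hx, hP⟩ := hP
    exact ⟨s', Δ', hx, Δ, _, _, hΘ.ext_right _, hR.renV (Res.some_wk _).toRen,
      hP.renV (ren_swap _ _ _)⟩
  | chopWait x P s R =>
    obtain ⟨Δ, Θ₁, Θ₂, hΘ, hR, hx, hP⟩ := hP
    exact ⟨hx, Δ, _, _, hΘ, hR, hP⟩

theorem Red.der {C V T : Type} {P Q : Proc C V T} (h : Red P Q) {Θ : PEnv V T}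
    {Γ : Env C T} (hΓ : Ctx.Finite Γ) (hP : P.Der Θ Γ) : Q.Der Θ Γ := by
  induction h with
  | principal h => exact h.der hP
  | eta h => exact h.der hP
  | commute h => exact h.der hΓ hP
  | cutL _ ih =>
    obtain ⟨Θ₁, Θ₂, Γ₁, Γ₂, hΘ, hj, hP, hQ⟩ := hP
    exact ⟨_, _, _, _, hΘ, hj, ih ((hj.finite_left hΓ).ext _) hP, hQ⟩
  | cutR _ ih =>
    obtain ⟨Θ₁, Θ₂, Γ₁, Γ₂, hΘ, hj, hP, hQ⟩ := hP
    exact ⟨_, _, _, _, hΘ, hj, hP, ih ((hj.finite_right hΓ).ext _) hQ⟩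
  | chop _ ih =>
    obtain ⟨Δ, Θ₁, Θ₂, hΘ, hP, hQ⟩ := hP
    exact ⟨Δ, _, _, hΘ, hP, ih hΓ hQ⟩
  | equiv h₁ _ h₂ ih => exact (h₂.der_iff _ _).1 (ih hΓ ((h₁.der_iff _ _).1 hP))

end CHOP

theorem theorem1 {C V T : Type} (Θ : CHOP.PEnv V T) (P : CHOP.Proc C V T) (Γ : CHOP.Env C T)
    (h : CHOP.Typed Θ P Γ) :
    (∀ Q : CHOP.Proc C V T, CHOP.SEquiv P Q → CHOP.Typed Θ Q Γ) ∧
      (∀ Q : CHOP.Proc C V T, CHOP.Red P Q → CHOP.Typed Θ Q Γ) :=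
  ⟨fun _ hQ => ((hQ.der_iff Θ Γ).1 h.der).typed h.finite,
    fun _ hQ => (hQ.der h.finite h.der).typed h.finite⟩
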